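/- Let $\mathcal H$ be a finite-dimensional complex Hilbert space. A quantum channel is a completely positive trace-preserving linear map on $\mathcal B(\mathcal H)$. A quantum channel $\Phi$ is infinitely divisible if for every integer $n\ge 1$ there is a quantum channel $\Phi_n$ on $\mathcal B(\mathcal H)$ with $\Phi=\Phi_n^n$ ($n$-fold composition). Let $\mathrm{Attr}(\Phi)$ be the span of the eigenvectors of $\Phi$ with eigenvalues of modulus $1$; the asymptotic map of $\Phi$ is the restriction $\hat\Phi_P=\Phi|_{\mathrm{Attr}(\Phi)}:\mathrm{Attr}(\Phi)\to\mathrm{Attr}(\Phi)$. Let $\mathcal P$ be the eigenprojection (spectral projection) of $\Phi$ at the eigenvalue $1$, and $\mathcal H_0=\operatorname{Ran}\mathcal P(\mathbb I)$. A block form of the asymptotic map consists of a decomposition $$\mathcal H=\mathcal H_0^\perp\oplus\bigoplus_{k=1}^M\mathcal H_{k,1}\otimes\mathcal H_{k,2}$$ with nonzero Hilbert spaces $\mathcal H_{k,i}$, positive definite density operators $\rho_k$ on $\mathcal H_{k,2}$, a permutation $\pi$ of $\{1,\dots,M\}$ and unitaries $U_k:\mathcal H_{\pi(k),1}\to\mathcal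 H_{k,1}$, such that $$\mathrm{Attr}(\Phi)=0\oplus\bigoplus_{k=1}^M\mathcal B(\mathcal H_{k,1})\otimes\mathbb C\rho_k,\qquad \hat\Phi_P\Bigl(0\oplus\bigoplus_{k=1}^M x_k\otimes\rho_k\Bigr)=0\oplus\bigoplus_{k=1}^M U_kx_{\pi(k)}U_k^\dagger\otimes\rho_k$$ for all $x_k\in\mathcal B(\mathcal H_{k,1})$. Theorem 5.1. Let $\Phi$ be an infinitely divisible quantum channel on $\mathcal B(\mathcal H)$. Then its asymptotic map has a block form, and in every block form $\pi=\mathrm{id}$. Hence the asymptotic dynamics is unitary: there is a unitary $U\in\mathcal B(\mathcal H)$ with $\hat\Phi_P(X)=UXU^\dagger$ for all $X\in\mathrm{Attr}(\Phi)$. -/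

import Mathlib

open scoped Kronecker Matrix ComplexOrder

noncomputable section

namespace QuantumAsymptotics

variable {H : Type*} [NormedAddCommGroup H] [InnerProductSpace ℂ H]

/-- A linear map on `B(H)` is a quantum channel if it is completely positive and trace
preserving. -/
structure IsQuantumChannel [CompleteSpace H] (Φ : Module.End ℂ (H →L[ℂ] H)) : Prop where
  completelyPositive : ∃ Ψ : CompletelyPositiveMap (H →L[ℂ] H) (H →L[ℂ] H), Ψ.toLinearMap = Φ
  trace_preserving : ∀ X : H →L[ℂ] H,
    LinearMap.trace ℂ H (Φ X : H →ₗ[ℂ] H) = LinearMap.trace ℂ H (X : H →ₗ[ℂ] H)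

/-- `Φ` is an infinitely divisible channel if for all `n ≥ 1` it is the `n`-fold composition of a
quantum channel with itself. -/
def IsInfinitelyDivisible [CompleteSpace H] (Φ : Module.End ℂ (H →L[ℂ] H)) : Prop :=
  IsQuantumChannel Φ ∧
    ∀ n : ℕ, 1 ≤ n → ∃ Ψ : Module.End ℂ (H →L[ℂ] H), IsQuantumChannel Ψ ∧ Φ = Ψ ^ n

/-- The eigenvalues of modulus one. -/
def peripheralSpectrum (Φ : Module.End ℂ (H →L[ℂ] H)) : Set ℂ :=
  {μ | Φ.HasEigenvalue μ ∧ ‖μ‖ = 1}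

/-- The attractor subspace: the span of the eigenvectors for the peripheral eigenvalues. -/
def attractor (Φ : Module.End ℂ (H →L[ℂ] H)) : Submodule ℂ (H →L[ℂ] H) :=
  ⨆ μ ∈ peripheralSpectrum Φ, Φ.eigenspace μ

theorem map_mem_attractor (Φ : Module.End ℂ (H →L[ℂ] H)) :
    ∀ X ∈ attractor Φ, Φ X ∈ attractor Φ := by
  intro X hX
  have h : attractor Φ ≤ (attractor Φ).comap Φ := by
    refine iSup₂_le fun μ hμ Y hY => ?_
    rw [Submodule.mem_comap, Module.End.mem_eigenspace_iff.mp hY]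
    exact Submodule.smul_mem _ _
      ((le_iSup₂ (f := fun μ (_ : μ ∈ peripheralSpectrum Φ) => Φ.eigenspace μ) μ hμ) hY)
  exact h hX

/-- The asymptotic map: the restriction of `Φ` to its attractor subspace. -/
def asymptoticMap (Φ : Module.End ℂ (H →L[ℂ] H)) : attractor Φ →ₗ[ℂ] attractor Φ :=
  Φ.restrict (map_mem_attractor Φ)

/-- The asymptotic map is unitary if it is conjugation by a unitary operator of `H`. -/
def HasUnitaryAsymptotics [CompleteSpace H] (Φ : Module.End ℂ (H →L[ℂ] H)) : Prop :=
  ∃ U ∈ unitary (H →L[ℂ] H), ∀ X : attractor Φ,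
    (asymptoticMap Φ X : H →L[ℂ] H) = U * (X : H →L[ℂ] H) * star U

/-- The spectral projection (eigenprojection) of `Φ` at `μ`: the projection onto the generalized
eigenspace at `μ`, along the complementary invariant subspace on which `Φ - μ` is invertible. -/
def eigenprojection [FiniteDimensional ℂ H] (Φ : Module.End ℂ (H →L[ℂ] H)) (μ : ℂ) :
    Module.End ℂ (H →L[ℂ] H) :=
  Submodule.projection _ _ (LinearMap.isCompl_iSup_ker_pow_iInf_range_pow (Φ - μ • 1))

/-- The operator `0 ⊕ ⨁ₖ xₖ ⊗ ρₖ` on `H`, where the isometry `V` identifies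
`⨁ₖ ℂ^(d k) ⊗ ℂ^(m k)` with a subspace of `H`, and `0` acts on the orthogonal complement of
that subspace. -/
def blockOperator [CompleteSpace H] [FiniteDimensional ℂ H] {M : ℕ} {d m : Fin M → ℕ}
    (V : EuclideanSpace ℂ (Σ k, Fin (d k) × Fin (m k)) →ₗᵢ[ℂ] H)
    (x : ∀ k, Matrix (Fin (d k)) (Fin (d k)) ℂ) (ρ : ∀ k, Matrix (Fin (m k)) (Fin (m k)) ℂ) :
    H →L[ℂ] H :=
  V.toContinuousLinearMap ∘L
    (Matrix.toEuclideanCLM (𝕜 := ℂ) (Matrix.blockDiagonal' fun k => x k ⊗ₖ ρ k)) ∘L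
      ContinuousLinearMap.adjoint V.toContinuousLinearMap

/-- A block form of the asymptotic map of `Φ`: a decomposition
`H = H₀ᗮ ⊕ ⨁ₖ Hₖ₁ ⊗ Hₖ₂` with nonzero factors `Hₖ₁ = ℂ^(d k)`, `Hₖ₂ = ℂ^(m k)`, density operators
`ρₖ > 0` on `Hₖ₂`, a permutation `π` of the blocks and unitaries `Uₖ : H_{π(k)1} → Hₖ₁` such that
`Attr Φ = 0 ⊕ ⨁ₖ B(Hₖ₁) ⊗ ℂ ρₖ` and
`Φ (0 ⊕ ⨁ₖ xₖ ⊗ ρₖ) = 0 ⊕ ⨁ₖ Uₖ x_{π(k)} Uₖ† ⊗ ρₖ`.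
(Existence of `Uₖ` forces `d (π k) = d k`; `ρ_trace` forces `m k ≠ 0`.) -/
structure AsymptoticForm [CompleteSpace H] [FiniteDimensional ℂ H] (Φ : Module.End ℂ (H →L[ℂ] H)) where
  /-- the number of blocks -/
  M : ℕ
  /-- the dimensions of the first factors -/
  d : Fin M → ℕ
  /-- the dimensions of the second factors -/
  m : Fin M → ℕ
  d_pos : ∀ k, 0 < d k
  /-- the embedding of the direct sum of the blocks in `H`, with range `H₀` -/
  V : EuclideanSpace ℂ (Σ k, Fin (d k) × Fin (m k)) →ₗᵢ[ℂ] H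
  /-- `H₀` is the range (support) of the image of the identity operator under the eigenprojection
  at the eigenvalue one -/
  range_V : LinearMap.range V.toLinearMap =
    LinearMap.range (eigenprojection Φ 1 (1 : H →L[ℂ] H) : H →ₗ[ℂ] H)
  /-- the fixed density operators -/
  ρ : ∀ k, Matrix (Fin (m k)) (Fin (m k)) ℂ
  ρ_posDef : ∀ k, (ρ k).PosDef
  ρ_trace : ∀ k, (ρ k).trace = 1
  attractor_eq : (attractor Φ : Set (H →L[ℂ] H)) = Set.range fun x => blockOperator V x ρ
  /-- the permutation of the blocks -/
  π : Equiv.Perm (Fin M)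
  /-- the unitaries -/
  U : ∀ k, Matrix (Fin (d k)) (Fin (d (π k))) ℂ
  U_mul_star : ∀ k, U k * (U k)ᴴ = 1
  star_mul_U : ∀ k, (U k)ᴴ * U k = 1
  map_eq : ∀ (X : attractor Φ) (x : ∀ k, Matrix (Fin (d k)) (Fin (d k)) ℂ),
    (X : H →L[ℂ] H) = blockOperator V x ρ →
      (asymptoticMap Φ X : H →L[ℂ] H) =
        blockOperator V (fun k => U k * x (π k) * (U k)ᴴ) ρ

end QuantumAsymptotics

end

/-!
A channel has Kraus operators, so its powers are uniformly bounded; hence the eigenvalue one is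
semisimple, `eigenprojection Φ 1 1` is a positive fixed point, and a Cauchy-Schwarz estimate
averaged over the powers shows that all peripheral eigenvectors live on the range of this fixed
point (`HasKrausForm.inner_eq_zero_of_eigenprojection_eq_zero`). Compressing to that range gives a
channel on matrices with an invertible fixed point `ω` (`HasKrausForm.exists_compression`).

For such a channel, write a peripheral eigenvector as `Z * ω`. Vanishing of a trace of positive
terms forces `L i * Z = μ • (Z * L i)` for all Kraus operators `L i`, and the dual computation gives
the same for `Zᴴ` (`kraus_mul_of_krausMap_eq`, `kraus_mul_conjTranspose`). So the peripheral
eigenvectors divided by `ω` span a star algebra, on which the channel acts as a star automorphism.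
By the structure of star subalgebras of matrix algebras (`exists_blockDiagonal_coordinates`, proved
with minimal projections and matrix units) the algebra is `⨁ₖ M_{d k} ⊗ 1`. As the peripheral span
is a bimodule over the algebra, `ω` may be replaced by some `⨁ₖ 1 ⊗ ρ k` in it, and this is
the description of the attractor subspace in `HasKrausForm.exists_attractor_form`.

Any channel `Ψ` whose attractor subspace is described by blocks thus induces a star automorphism of
`∏ₖ M_{d k}` (`HasKrausForm.exists_block_automorphism`), and this automorphism permutes the units of
the blocks (`exists_perm_map_single_one`). Let `Φ` be infinitely divisible, and write `Φ = Ψ ^ n`,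
where `n` is the order of the group of permutations of the blocks of `Φ`. Since `Φ` and `Ψ` have the
same attractor subspace (`peripheralSpan_pow`), the automorphism of `Φ` is the `n`-th power of that
of `Ψ`, and it fixes the unit of every block. Therefore the permutation in each block form is
trivial. Moreover the automorphism is implemented by a unitary in each block, trace preservation
makes these unitaries commute with the fixed point, and they assemble to a unitary of `H`.
-/

namespace QuantumAsymptotics

set_option linter.unusedSectionVars false

open InnerProductSpace Module

/-! ### Peripheral eigenvectors -/

section Peripheral

variable {E F : Type*} [AddCommGroup E] [Module ℂ E] [AddCommGroup F] [Module ℂ F]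

/-- The span of the eigenvectors of a linear endomorphism with eigenvalues of modulus one. -/
def peripheralSpan (f : End ℂ E) : Submodule ℂ E :=
  ⨆ μ : Metric.sphere (0 : ℂ) 1, f.eigenspace μ

theorem mem_peripheralSpan {f : End ℂ E} {μ : ℂ} (hμ : ‖μ‖ = 1) {X : E} (hX : f X = μ • X) :
    X ∈ peripheralSpan f :=
  le_iSup (fun μ : Metric.sphere (0 : ℂ) 1 => f.eigenspace μ) ⟨μ, by simpa using hμ⟩
    (End.mem_eigenspace_iff.mpr hX)

theorem peripheralSpan_le {f : End ℂ E} {p : Submodule ℂ E}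
    (h : ∀ (μ : ℂ) (X : E), ‖μ‖ = 1 → f X = μ • X → X ∈ p) : peripheralSpan f ≤ p :=
  iSup_le fun μ _ hX => h μ _ (by simp) (End.mem_eigenspace_iff.mp hX)

theorem peripheralSpan_induction {f : End ℂ E} {p : E → Prop}
    (eigen : ∀ (μ : ℂ) (X : E), ‖μ‖ = 1 → f X = μ • X → p X) (add : ∀ X Y, p X → p Y → p (X + Y))
    {X : E} (hX : X ∈ peripheralSpan f) : p X :=
  Submodule.iSup_induction (motive := p) _ hX
    (fun μ X hX => eigen μ X (by simp) (End.mem_eigenspace_iff.mp hX))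
    (eigen 1 0 (by simp) (by simp)) add

theorem map_mem_peripheralSpan {f : End ℂ E} {X : E} (hX : X ∈ peripheralSpan f) :
    f X ∈ peripheralSpan f := by
  refine peripheralSpan_induction (p := fun X => f X ∈ peripheralSpan f)
    (fun μ X hμ hX => ?_) (fun X Y hX hY => ?_) hX
  · rw [hX]; exact Submodule.smul_mem _ _ (mem_peripheralSpan hμ hX)
  · rw [map_add]; exact Submodule.add_mem _ hX hY

theorem exists_map_eq_of_mem_peripheralSpan {f : End ℂ E} {X : E} (hX : X ∈ peripheralSpan f) :
    ∃ Y ∈ peripheralSpan f, f Y = X := by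
  refine peripheralSpan_induction (p := fun X => ∃ Y ∈ peripheralSpan f, f Y = X)
    (fun μ X hμ hX => ?_) (fun X Y hX hY => ?_) hX
  · have h0 : μ ≠ 0 := by rintro rfl; simp at hμ
    exact ⟨μ⁻¹ • X, Submodule.smul_mem _ _ (mem_peripheralSpan hμ hX), by
      rw [map_smul, hX, smul_smul, inv_mul_cancel₀ h0, one_smul]⟩
  · obtain ⟨X', hX', rfl⟩ := hX
    obtain ⟨Y', hY', rfl⟩ := hY
    exact ⟨X' + Y', Submodule.add_mem _ hX' hY', map_add _ _ _⟩

/-- A root of unity decomposition: an eigenvector of `f ^ n` for a peripheral eigenvalue is a sum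
of eigenvectors of `f` for the `n`-th roots of that eigenvalue. -/
theorem peripheralSpan_pow (f : End ℂ E) {n : ℕ} (hn : n ≠ 0) :
    peripheralSpan (f ^ n) = peripheralSpan f := by
  apply le_antisymm
  · refine peripheralSpan_le fun μ X hμ hX => ?_
    obtain ⟨l, hl⟩ := IsAlgClosed.exists_pow_nat_eq μ (Nat.pos_of_ne_zero hn)
    have hl1 : ‖l‖ = 1 := by
      rw [← pow_eq_one_iff_of_nonneg (norm_nonneg l) hn, ← norm_pow, hl, hμ]
    have hl0 : l ≠ 0 := by rintro rfl; simp at hl1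
    have hζ := Complex.isPrimitiveRoot_exp n hn
    set ζ := Complex.exp (2 * Real.pi * Complex.I / n)
    have hζ0 : ζ ≠ 0 := hζ.ne_zero hn
    have hζ1 : ‖ζ‖ = 1 := hζ.norm'_eq_one hn
    -- `Z j` is `n` times the component of `X` in the eigenspace of `f` at `l * ζ ^ j`
    let Z : ℕ → E := fun j => ∑ k ∈ Finset.range n, ((l * ζ ^ j)⁻¹ ^ k) • (f ^ k) X
    have hZ : ∀ j, f (Z j) = (l * ζ ^ j) • Z j := by
      intro j
      have hne : l * ζ ^ j ≠ 0 := mul_ne_zero hl0 (pow_ne_zero _ hζ0)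
      have hcn : (l * ζ ^ j) ^ n = μ := by
        rw [mul_pow, hl, ← pow_mul, mul_comm j n, pow_mul, hζ.pow_eq_one, one_pow, mul_one]
      set c := l * ζ ^ j
      have h1 : f (Z j) = c • ∑ k ∈ Finset.range n, (c⁻¹ ^ (k + 1)) • (f ^ (k + 1)) X := by
        simp only [Z, map_sum, map_smul, Finset.smul_sum, smul_smul]
        refine Finset.sum_congr rfl fun k _ => ?_
        rw [pow_succ c⁻¹, mul_comm (c⁻¹ ^ k), mul_inv_cancel_left₀ hne, pow_succ' f,
          Module.End.mul_apply]
      have h2 : ∑ k ∈ Finset.range n, (c⁻¹ ^ (k + 1)) • (f ^ (k + 1)) X = Z j := by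
        have := Finset.sum_range_succ' (fun k => (c⁻¹ ^ k) • (f ^ k) X) n
        rw [Finset.sum_range_succ] at this
        have h3 : (c⁻¹ ^ n) • (f ^ n) X = X := by
          rw [hX, smul_smul, inv_pow, hcn, inv_mul_cancel₀, one_smul]
          rintro rfl; simp at hμ
        rw [h3] at this
        simpa [Z, c] using this.symm
      rw [h1, h2]
    have hsum : ∑ j ∈ Finset.range n, Z j = (n : ℂ) • X := by
      simp only [Z]
      rw [Finset.sum_comm, Finset.sum_eq_single 0]
      · simp [Nat.cast_smul_eq_nsmul]
      · intro k hk hk0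
        rw [← Finset.sum_smul]
        have : ∑ j ∈ Finset.range n, (l * ζ ^ j)⁻¹ ^ k = 0 := by
          have h4 : ∀ j, (l * ζ ^ j)⁻¹ ^ k = l⁻¹ ^ k * ((ζ⁻¹ ^ k) ^ j) := by
            intro j
            rw [mul_inv, mul_pow, ← inv_pow, ← pow_mul, ← pow_mul, mul_comm j k]
          simp only [h4]
          rw [← Finset.mul_sum]
          have h5 : ζ⁻¹ ^ k ≠ 1 := hζ.inv.pow_ne_one_of_pos_of_lt hk0 (Finset.mem_range.mp hk)
          have h6 := geom_sum_mul (ζ⁻¹ ^ k) n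
          rw [← pow_mul, mul_comm k n, pow_mul, hζ.inv.pow_eq_one, one_pow, sub_self] at h6
          rw [(mul_eq_zero.mp h6).resolve_right (sub_ne_zero.mpr h5), mul_zero]
        rw [this, zero_smul]
      · intro h; exact absurd (Finset.mem_range.mpr (Nat.pos_of_ne_zero hn)) h
    have hX' : X = (n : ℂ)⁻¹ • ∑ j ∈ Finset.range n, Z j := by
      rw [hsum, smul_smul, inv_mul_cancel₀ (Nat.cast_ne_zero.mpr hn), one_smul]
    rw [hX']
    refine Submodule.smul_mem _ _ (Submodule.sum_mem _ fun j _ => mem_peripheralSpan ?_ (hZ j))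
    rw [norm_mul, norm_pow, hl1, hζ1, one_pow, mul_one]
  · refine peripheralSpan_le fun μ X hμ hX => mem_peripheralSpan (μ := μ ^ n) (by simp [hμ]) ?_
    clear hn
    induction n with
    | zero => simp
    | succ k ih => rw [pow_succ, Module.End.mul_apply, hX, map_smul, ih, smul_smul, pow_succ']

/-- An injective map that intertwines `f` and `g`, and whose range contains the peripheral
eigenvectors of `g`, identifies the peripheral spans. -/
theorem map_peripheralSpan {f : End ℂ E} {g : End ℂ F} (j : E →ₗ[ℂ] F)
    (hj : Function.Injective j) (hfg : ∀ X, g (j X) = j (f X))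
    (hr : ∀ (μ : ℂ) (Y : F), ‖μ‖ = 1 → g Y = μ • Y → Y ∈ LinearMap.range j) :
    peripheralSpan g = (peripheralSpan f).map j := by
  apply le_antisymm
  · refine peripheralSpan_le fun μ Y hμ hY => ?_
    obtain ⟨X, rfl⟩ := hr μ Y hμ hY
    refine Submodule.mem_map_of_mem (mem_peripheralSpan hμ (hj ?_))
    rw [← hfg, hY, map_smul]
  · rw [Submodule.map_le_iff_le_comap]
    refine peripheralSpan_le fun μ X hμ hX => mem_peripheralSpan hμ ?_
    rw [hfg, hX, map_smul]

end Peripheral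

section Attractor

variable {H : Type*} [NormedAddCommGroup H] [InnerProductSpace ℂ H]

theorem attractor_eq_peripheralSpan (Φ : Module.End ℂ (H →L[ℂ] H)) :
    attractor Φ = peripheralSpan Φ := by
  apply le_antisymm
  · exact iSup₂_le fun μ hμ X hX => mem_peripheralSpan hμ.2 (End.mem_eigenspace_iff.mp hX)
  · refine peripheralSpan_le fun μ X hμ hX => ?_
    rcases eq_or_ne X 0 with rfl | h0
    · exact Submodule.zero_mem _
    · have hX' := End.mem_eigenspace_iff.mpr hX
      exact le_iSup₂ (f := fun μ (_ : μ ∈ peripheralSpectrum Φ) => Φ.eigenspace μ) μ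
        ⟨End.hasEigenvalue_of_hasEigenvector ⟨hX', h0⟩, hμ⟩ hX'

end Attractor

/-! ### Kraus form of a channel -/

section Kraus

variable {H : Type*} [NormedAddCommGroup H] [InnerProductSpace ℂ H] [CompleteSpace H]
  [FiniteDimensional ℂ H]

theorem exists_eq_star_mul_self_of_nonneg {A : Type*} [NonUnitalCStarAlgebra A] [PartialOrder A]
    [StarOrderedRing A] {a : A} (ha : 0 ≤ a) : ∃ b : A, a = star b * b :=
  CStarAlgebra.nonneg_iff_eq_star_mul_self.mp ha

/-- A completely positive map `X ↦ ∑ i, K i * X * (K i)†` is read off from the image of the Choi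
matrix, which is a positive element `c† c` of the matrix algebra over `B(H)`. -/
theorem exists_kraus_of_completelyPositive
    (Ψ : CompletelyPositiveMap (H →L[ℂ] H) (H →L[ℂ] H)) :
    ∃ K : Fin (finrank ℂ H) × Fin (finrank ℂ H) → H →L[ℂ] H,
      ∀ X, Ψ.toLinearMap X = ∑ i, K i * X * star (K i) := by
  set n := finrank ℂ H
  let e := stdOrthonormalBasis ℂ H
  let B : CStarMatrix (Fin n) (Fin n) (H →L[ℂ] H) := CStarMatrix.ofMatrix fun i j =>
    rankOne ℂ (e i) (e j)
  have hB : ∀ i j, (star B * B) i j = (n : ℂ) • rankOne ℂ (e i) (e j) := by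
    intro i j
    rw [CStarMatrix.mul_apply]
    have : ∀ l, (star B) i l * B l j = rankOne ℂ (e i) (e j) := by
      intro l
      have h1 : (star B) i l = rankOne ℂ (e i) (e l) := by
        rw [CStarMatrix.star_apply]
        exact (ContinuousLinearMap.star_eq_adjoint _).trans (adjoint_rankOne _ _)
      rw [h1]
      change rankOne ℂ (e i) (e l) ∘L rankOne ℂ (e l) (e j) = _
      rw [rankOne_comp_rankOne]
      simp
    simp only [this]
    simp [Nat.cast_smul_eq_nsmul]
  obtain ⟨c, hc⟩ : ∃ c : Fin n → Fin n → H →L[ℂ] H, ∀ i j,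
      Ψ.toLinearMap ((n : ℂ) • rankOne ℂ (e i) (e j)) = ∑ l, star (c l i) * c l j := by
    obtain ⟨c, hc⟩ := exists_eq_star_mul_self_of_nonneg
      (Ψ.map_cstarMatrix_nonneg' n _ (star_mul_self_nonneg B))
    refine ⟨fun i j => c i j, fun i j => ?_⟩
    have := congrFun (congrFun hc i) j
    rw [CStarMatrix.mul_apply] at this
    rw [← hB]
    exact this
  -- Kraus operators: `K (l, p)` sends the basis vector `e i` to `n^(-1/2) (c l i)† (e p)`
  let r : ℂ := ((Real.sqrt n : ℝ) : ℂ)⁻¹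
  refine ⟨fun lp => r • ∑ i, rankOne ℂ (star (c lp.1 i) (e lp.2)) (e i), fun X => ?_⟩
  rcases Nat.eq_zero_or_pos n with hn | hn
  · have : Subsingleton H := Module.finrank_zero_iff.mp hn
    exact Subsingleton.elim _ _
  have hr : r * star r = (n : ℂ)⁻¹ := by
    simp only [r, star_inv₀, RCLike.star_def, Complex.conj_ofReal]
    rw [← mul_inv, ← Complex.ofReal_mul, Real.mul_self_sqrt (Nat.cast_nonneg n)]
    simp
  have hX : X = ∑ i, ∑ j, inner ℂ (e i) (X (e j)) • rankOne ℂ (e i) (e j) := by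
    ext v
    simp only [sum_apply, smul_apply, rankOne_apply]
    rw [Finset.sum_comm]
    conv_lhs => rw [← e.sum_repr' v, map_sum]
    refine Finset.sum_congr rfl fun j _ => ?_
    rw [map_smul]
    conv_lhs => rw [← e.sum_repr' (X (e j)), Finset.smul_sum]
    exact Finset.sum_congr rfl fun i _ => smul_comm _ _ _
  have hn0 : (n : ℂ) ≠ 0 := Nat.cast_ne_zero.mpr hn.ne'
  have hΨ : ∀ i j, Ψ.toLinearMap (rankOne ℂ (e i) (e j)) =
      (n : ℂ)⁻¹ • ∑ l, star (c l i) * c l j := by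
    intro i j
    rw [← hc, map_smul, smul_smul, inv_mul_cancel₀ hn0, one_smul]
  have hK : ∀ l p, (r • ∑ i, rankOne ℂ (star (c l i) (e p)) (e i)) * X *
      star (r • ∑ i, rankOne ℂ (star (c l i) (e p)) (e i)) = (n : ℂ)⁻¹ •
        ∑ i, ∑ j, inner ℂ (e i) (X (e j)) • (star (c l i) * rankOne ℂ (e p) (e p) * c l j) := by
    intro l p
    rw [star_smul, smul_mul_assoc, smul_mul_assoc, mul_smul_comm, smul_smul, hr, star_sum,
      Finset.sum_mul, Finset.sum_mul]
    congr 1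
    refine Finset.sum_congr rfl fun i _ => ?_
    rw [Finset.mul_sum]
    refine Finset.sum_congr rfl fun j _ => ?_
    ext v
    simp only [mul_apply_eq_comp, smul_apply, rankOne_apply,
      ContinuousLinearMap.star_eq_adjoint, adjoint_rankOne, map_smul, smul_smul,
      ContinuousLinearMap.adjoint_inner_left]
    rw [mul_comm]
  conv_lhs => rw [hX]
  simp only [map_sum, map_smul, hΨ]
  rw [Fintype.sum_prod_type]
  simp only [hK]
  have hp : ∀ l, ∑ p, (n : ℂ)⁻¹ •
        ∑ i, ∑ j, inner ℂ (e i) (X (e j)) • (star (c l i) * rankOne ℂ (e p) (e p) * c l j) =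
      ∑ i, ∑ j, inner ℂ (e i) (X (e j)) • (n : ℂ)⁻¹ • (star (c l i) * c l j) := by
    intro l
    have hid : ∑ p, rankOne ℂ (e p) (e p) = 1 := e.sum_rankOne_eq_id
    rw [← Finset.smul_sum, Finset.sum_comm, Finset.smul_sum]
    refine Finset.sum_congr rfl fun i _ => ?_
    rw [Finset.sum_comm, Finset.smul_sum]
    refine Finset.sum_congr rfl fun j _ => ?_
    rw [← Finset.smul_sum, ← Finset.sum_mul, ← Finset.mul_sum, hid, mul_one, smul_comm]
  refine Eq.trans ?_ (Finset.sum_congr rfl fun l _ => (hp l).symm)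
  refine Eq.symm (Finset.sum_comm.trans ?_)
  refine Finset.sum_congr rfl fun i _ => ?_
  rw [Finset.sum_comm]
  refine Finset.sum_congr rfl fun j _ => ?_
  rw [← Finset.smul_sum, ← Finset.smul_sum]

theorem IsQuantumChannel.exists_kraus {Φ : Module.End ℂ (H →L[ℂ] H)} (h : IsQuantumChannel Φ) :
    ∃ K : Fin (finrank ℂ H) × Fin (finrank ℂ H) → H →L[ℂ] H,
      (∀ X, Φ X = ∑ i, K i * X * star (K i)) ∧ ∑ i, star (K i) * K i = 1 := by
  obtain ⟨Ψ, rfl⟩ := h.completelyPositive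
  obtain ⟨K, hK⟩ := exists_kraus_of_completelyPositive Ψ
  refine ⟨K, hK, ?_⟩
  ext v
  refine ext_inner_left ℂ fun w => ?_
  have h1 := h.trace_preserving (rankOne ℂ v w)
  rw [trace_rankOne, hK] at h1
  rw [one_apply_eq_self, ← h1]
  have h2 : ∀ i, K i * rankOne ℂ v w * star (K i) = rankOne ℂ (K i v) (K i w) := by
    intro i
    ext u
    simp [ContinuousLinearMap.star_eq_adjoint,
      ContinuousLinearMap.adjoint_inner_right]
  simp only [h2, sum_apply, inner_sum]
  rw [ContinuousLinearMap.toLinearMap_sum, map_sum]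
  refine Finset.sum_congr rfl fun i _ => ?_
  rw [trace_rankOne, mul_apply_eq_comp, ContinuousLinearMap.star_eq_adjoint,
    ContinuousLinearMap.adjoint_inner_right]

end Kraus

/-! ### Ergodic averages and the support of the peripheral eigenvectors -/

section Ergodic

variable {H : Type*} [NormedAddCommGroup H] [InnerProductSpace ℂ H] [CompleteSpace H]

/-- `Φ` is given by Kraus operators `K i` with `∑ i, (K i)† * K i = 1`. -/
def HasKrausForm (Φ : End ℂ (H →L[ℂ] H)) : Prop :=
  ∃ (ι : Type) (_ : Fintype ι) (K : ι → H →L[ℂ] H),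
    (∀ X, Φ X = ∑ i, K i * X * star (K i)) ∧ ∑ i, star (K i) * K i = 1

theorem HasKrausForm.one : HasKrausForm (1 : End ℂ (H →L[ℂ] H)) :=
  ⟨Unit, inferInstance, fun _ => 1, by simp, by simp⟩

theorem HasKrausForm.mul {Φ Ψ : End ℂ (H →L[ℂ] H)} (hΦ : HasKrausForm Φ) (hΨ : HasKrausForm Ψ) :
    HasKrausForm (Φ * Ψ) := by
  obtain ⟨ι, _, K, hK, hK1⟩ := hΦ
  obtain ⟨κ, _, L, hL, hL1⟩ := hΨ
  refine ⟨ι × κ, inferInstance, fun p => K p.1 * L p.2, fun X => ?_, ?_⟩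
  · simp only [Module.End.mul_apply, hK, hL, Fintype.sum_prod_type, star_mul, Finset.mul_sum,
      Finset.sum_mul, mul_assoc]
  · rw [Fintype.sum_prod_type, Finset.sum_comm]
    have h : ∀ j, ∑ i, star (K i * L j) * (K i * L j) = star (L j) * L j := by
      intro j
      have : star (L j) * (∑ i, star (K i) * K i) * L j = star (L j) * L j := by
        rw [hK1, mul_one]
      rw [← this]
      simp only [star_mul, Finset.mul_sum, Finset.sum_mul, mul_assoc]
    simp only [h, hL1]

theorem HasKrausForm.pow {Φ : End ℂ (H →L[ℂ] H)} (hΦ : HasKrausForm Φ) (n : ℕ) :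
    HasKrausForm (Φ ^ n) := by
  induction n with
  | zero => exact HasKrausForm.one
  | succ n ih => rw [pow_succ]; exact ih.mul hΦ

theorem HasKrausForm.apply_star {Φ : End ℂ (H →L[ℂ] H)} (hΦ : HasKrausForm Φ) (X : H →L[ℂ] H) :
    Φ (star X) = star (Φ X) := by
  obtain ⟨ι, _, K, hK, hK1⟩ := hΦ
  simp only [hK, star_sum, star_mul, star_star, mul_assoc]

theorem inner_kraus_apply {ι : Type*} [Fintype ι] (K : ι → H →L[ℂ] H) (X : H →L[ℂ] H) (v w : H) :
    inner ℂ v ((∑ i, K i * X * star (K i)) w) =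
      ∑ i, inner ℂ (star (K i) v) (X (star (K i) w)) := by
  simp only [sum_apply, inner_sum, mul_apply_eq_comp, ContinuousLinearMap.star_eq_adjoint,
    ContinuousLinearMap.adjoint_inner_left]

theorem HasKrausForm.re_inner_map_one_eq {Φ : End ℂ (H →L[ℂ] H)} {ι : Type*} [Fintype ι]
    {K : ι → H →L[ℂ] H} (hK : ∀ X, Φ X = ∑ i, K i * X * star (K i)) (v : H) :
    inner ℂ v (Φ 1 v) = ((∑ i, ‖star (K i) v‖ ^ 2 : ℝ) : ℂ) := by
  rw [hK, inner_kraus_apply, Complex.ofReal_sum]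
  refine Finset.sum_congr rfl fun i _ => ?_
  rw [one_apply_eq_self, inner_self_eq_norm_sq_to_K, Complex.ofReal_pow]
  rfl

/-- A Cauchy-Schwarz inequality for channels: matrix coefficients of `Φ X` are dominated by those
of `Φ 1`. -/
theorem HasKrausForm.norm_inner_le {Φ : End ℂ (H →L[ℂ] H)} (hΦ : HasKrausForm Φ)
    (X : H →L[ℂ] H) (v w : H) : ‖inner ℂ v (Φ X w)‖ ≤
      ‖X‖ / 2 * ((inner ℂ v (Φ 1 v)).re + (inner ℂ w (Φ 1 w)).re) := by
  obtain ⟨ι, _, K, hK, -⟩ := hΦ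
  rw [re_inner_map_one_eq hK, re_inner_map_one_eq hK, Complex.ofReal_re, Complex.ofReal_re,
    ← Finset.sum_add_distrib, Finset.mul_sum, hK, inner_kraus_apply]
  refine (norm_sum_le _ _).trans (Finset.sum_le_sum fun i _ => ?_)
  have h1 := _root_.norm_inner_le_norm (𝕜 := ℂ) (star (K i) v) (X (star (K i) w))
  have h2 := X.le_opNorm (star (K i) w)
  have h3 : ‖star (K i) v‖ * ‖X (star (K i) w)‖ ≤
      ‖star (K i) v‖ * (‖X‖ * ‖star (K i) w‖) := by gcongr
  nlinarith [mul_nonneg (norm_nonneg X) (sq_nonneg (‖star (K i) v‖ - ‖star (K i) w‖))]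

theorem HasKrausForm.re_inner_map_one_nonneg {Φ : End ℂ (H →L[ℂ] H)} (hΦ : HasKrausForm Φ)
    (v : H) : 0 ≤ (inner ℂ v (Φ 1 v)).re := by
  obtain ⟨ι, _, K, hK, -⟩ := hΦ
  rw [re_inner_map_one_eq hK, Complex.ofReal_re]
  exact Finset.sum_nonneg fun i _ => by positivity

theorem HasKrausForm.im_inner_map_one {Φ : End ℂ (H →L[ℂ] H)} (hΦ : HasKrausForm Φ)
    (v : H) : (inner ℂ v (Φ 1 v)).im = 0 := by
  obtain ⟨ι, _, K, hK, -⟩ := hΦ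
  rw [re_inner_map_one_eq hK, Complex.ofReal_im]

variable [FiniteDimensional ℂ H]

/-- The bound is the trace of `Φ 1`, which equals the dimension. -/
theorem HasKrausForm.re_inner_map_one_le {Φ : End ℂ (H →L[ℂ] H)} (hΦ : HasKrausForm Φ) (v : H) :
    (inner ℂ v (Φ 1 v)).re ≤ ‖v‖ ^ 2 * finrank ℂ H := by
  obtain ⟨ι, _, K, hK, hK1⟩ := hΦ
  rw [re_inner_map_one_eq hK, Complex.ofReal_re]
  let e := stdOrthonormalBasis ℂ H
  have h1 : ∀ i, ‖star (K i) v‖ ^ 2 ≤ ∑ b, ‖v‖ ^ 2 * ‖K i (e b)‖ ^ 2 := by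
    intro i
    rw [← e.sum_sq_norm_inner_right (star (K i) v)]
    refine Finset.sum_le_sum fun b _ => ?_
    rw [ContinuousLinearMap.star_eq_adjoint, ContinuousLinearMap.adjoint_inner_right, ← mul_pow,
      mul_comm]
    gcongr
    exact _root_.norm_inner_le_norm _ _
  refine (Finset.sum_le_sum fun i _ => h1 i).trans ?_
  rw [Finset.sum_comm]
  have h2 : ∀ b, ∑ i, ‖v‖ ^ 2 * ‖K i (e b)‖ ^ 2 = ‖v‖ ^ 2 := by
    intro b
    rw [← Finset.mul_sum]
    have h3 : ((∑ i, ‖K i (e b)‖ ^ 2 : ℝ) : ℂ) = 1 := by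
      have h4 : inner ℂ (e b) ((∑ i, star (K i) * K i) (e b)) = 1 := by
        rw [hK1, one_apply_eq_self, inner_self_eq_norm_sq_to_K]; simp
      rw [← h4, sum_apply, inner_sum, Complex.ofReal_sum]
      refine Finset.sum_congr rfl fun i _ => ?_
      rw [mul_apply_eq_comp, ContinuousLinearMap.star_eq_adjoint,
        ContinuousLinearMap.adjoint_inner_right, inner_self_eq_norm_sq_to_K]
      simp
    have h5 : ∑ i, ‖K i (e b)‖ ^ 2 = 1 := by exact_mod_cast h3
    rw [h5, mul_one]
  simp only [h2]
  simp [mul_comm]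

theorem HasKrausForm.exists_norm_inner_pow_le {Φ : End ℂ (H →L[ℂ] H)} (hΦ : HasKrausForm Φ)
    (X : H →L[ℂ] H) (v w : H) : ∃ C : ℝ, ∀ n : ℕ, ‖inner ℂ v ((Φ ^ n) X w)‖ ≤ C := by
  refine ⟨‖X‖ / 2 * (‖v‖ ^ 2 * finrank ℂ H + ‖w‖ ^ 2 * finrank ℂ H), fun n => ?_⟩
  refine ((hΦ.pow n).norm_inner_le X v w).trans ?_
  gcongr
  · exact (hΦ.pow n).re_inner_map_one_le v
  · exact (hΦ.pow n).re_inner_map_one_le w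

theorem nonneg_of_forall_nat_mul_add_nonneg {a B : ℝ} (h : ∀ n : ℕ, 0 ≤ n * a + B) : 0 ≤ a := by
  by_contra! ha
  obtain ⟨n, hn⟩ := exists_nat_gt (B / -a)
  rw [div_lt_iff₀ (by linarith)] at hn
  linarith [h n]

/-- The eigenvalue one of a channel is semisimple, as the powers of the channel are bounded. -/
theorem HasKrausForm.map_eq_self {Φ : End ℂ (H →L[ℂ] H)} (hΦ : HasKrausForm Φ) {X : H →L[ℂ] H}
    (hX : Φ (Φ X - X) = Φ X - X) : Φ X = X := by
  rw [← sub_eq_zero]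
  ext w
  refine ext_inner_left ℂ fun v => ?_
  set Y := Φ X - X
  have hpow : ∀ n : ℕ, (Φ ^ n) X = X + (n : ℂ) • Y := by
    intro n
    induction n with
    | zero => simp
    | succ n ih =>
      rw [pow_succ', Module.End.mul_apply, ih, map_add, map_smul, hX]
      have : Φ X = X + Y := by simp [Y]
      rw [this]; push_cast; module
  obtain ⟨C, hC⟩ := hΦ.exists_norm_inner_pow_le X v w
  have h1 : ∀ n : ℕ, 0 ≤ n * (-‖inner ℂ v (Y w)‖) + (C + ‖inner ℂ v (X w)‖) := by
    intro n
    have h2 := hC n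
    rw [hpow, add_apply, smul_apply, inner_add_right, inner_smul_right] at h2
    have h3 : ‖(n : ℂ) * inner ℂ v (Y w)‖ ≤ ‖inner ℂ v (X w) + n * inner ℂ v (Y w)‖ +
        ‖inner ℂ v (X w)‖ := by
      have := norm_sub_le (inner ℂ v (X w) + n * inner ℂ v (Y w)) (inner ℂ v (X w))
      rwa [add_sub_cancel_left] at this
    rw [norm_mul, Complex.norm_natCast] at h3
    linarith
  have h4 := nonneg_of_forall_nat_mul_add_nonneg h1
  have h5 : ‖inner ℂ v (Y w)‖ = 0 := le_antisymm (by linarith) (norm_nonneg _)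
  simpa using h5

theorem HasKrausForm.ker_pow_le {Φ : End ℂ (H →L[ℂ] H)} (hΦ : HasKrausForm Φ) (k : ℕ) :
    LinearMap.ker ((Φ - (1 : ℂ) • 1) ^ k) ≤ LinearMap.ker (Φ - (1 : ℂ) • 1) := by
  induction k with
  | zero =>
    intro X hX
    rw [pow_zero, LinearMap.mem_ker, Module.End.one_apply] at hX
    rw [hX]
    exact Submodule.zero_mem _
  | succ k ih =>
    intro X hX
    rw [LinearMap.mem_ker, pow_succ, Module.End.mul_apply] at hX
    have h1 := LinearMap.mem_ker.mp (ih (LinearMap.mem_ker.mpr hX))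
    simp only [one_smul, LinearMap.sub_apply, Module.End.one_apply, LinearMap.mem_ker] at h1 ⊢
    exact sub_eq_zero.mpr (hΦ.map_eq_self (sub_eq_zero.mp h1))

/-- The eigenprojection at one maps onto fixed points, along the range of `Φ - 1`. -/
theorem HasKrausForm.eigenprojection_one_spec {Φ : End ℂ (H →L[ℂ] H)} (hΦ : HasKrausForm Φ)
    (X : H →L[ℂ] H) : Φ (eigenprojection Φ 1 X) = eigenprojection Φ 1 X ∧
      ∃ Y, X = eigenprojection Φ 1 X + (Φ Y - Y) := by
  have hc := LinearMap.isCompl_iSup_ker_pow_iInf_range_pow (Φ - (1 : ℂ) • 1)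
  constructor
  · have h1 : eigenprojection Φ 1 X ∈ LinearMap.ker (Φ - (1 : ℂ) • 1) :=
      (iSup_le fun k => hΦ.ker_pow_le k) (Submodule.projection_apply_mem hc X)
    simpa [sub_eq_zero] using h1
  · have h2 : X - eigenprojection Φ 1 X ∈ LinearMap.range ((Φ - (1 : ℂ) • 1) ^ 1) := by
      have h3 := Submodule.projection_apply_mem hc.symm X
      rw [Submodule.projection_eq_self_sub_projection hc] at h3
      exact (Submodule.mem_iInf _).mp h3 1
    obtain ⟨Y, hY⟩ := h2
    refine ⟨Y, ?_⟩
    rw [pow_one] at hY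
    have : Φ Y - Y = X - eigenprojection Φ 1 X := by simpa using hY
    rw [this]; abel

/-- The ergodic sums of `Φ` at the identity grow like multiples of the spectral projection. -/
theorem HasKrausForm.exists_sum_pow_one {Φ : End ℂ (H →L[ℂ] H)} (hΦ : HasKrausForm Φ) (v : H) :
    ∃ (B : ℝ) (b : ℕ → ℂ), (∀ N, ‖b N‖ ≤ B) ∧ ∀ N : ℕ,
      ∑ n ∈ Finset.range N, inner ℂ v ((Φ ^ n) 1 v) =
        N * inner ℂ v (eigenprojection Φ 1 1 v) + b N := by
  obtain ⟨h1, Y, hY⟩ := hΦ.eigenprojection_one_spec 1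
  obtain ⟨C, hC⟩ := hΦ.exists_norm_inner_pow_le Y v v
  refine ⟨C + ‖inner ℂ v (Y v)‖, fun N => inner ℂ v ((Φ ^ N) Y v) - inner ℂ v (Y v),
    fun N => (norm_sub_le _ _).trans (by linarith [hC N]), fun N => ?_⟩
  have hfix : ∀ n : ℕ, (Φ ^ n) (eigenprojection Φ 1 1) = eigenprojection Φ 1 1 := by
    intro n
    induction n with
    | zero => simp
    | succ n ih => rw [pow_succ, Module.End.mul_apply, h1, ih]
  have hsum : ∑ n ∈ Finset.range N, (Φ ^ n) 1 =
      (N : ℂ) • eigenprojection Φ 1 1 + ((Φ ^ N) Y - Y) := by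
    induction N with
    | zero => simp
    | succ N ih =>
      have h2 := congrArg (Φ ^ N) hY
      rw [map_add, map_sub, hfix, ← Module.End.mul_apply, ← pow_succ] at h2
      rw [Finset.sum_range_succ, ih, h2]
      push_cast
      module
  rw [← inner_sum, ← sum_apply, hsum, add_apply, smul_apply, sub_apply, inner_add_right,
    inner_smul_right, inner_sub_right]

/-- The ergodic averages of `Φ` at the identity are positive and converge to
`eigenprojection Φ 1 1`. -/
theorem HasKrausForm.isPositive_eigenprojection_one {Φ : End ℂ (H →L[ℂ] H)}
    (hΦ : HasKrausForm Φ) : (eigenprojection Φ 1 1).IsPositive := by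
  rw [ContinuousLinearMap.isPositive_iff_complex]
  intro v
  obtain ⟨B, b, hb, hs⟩ := hΦ.exists_sum_pow_one v
  have hre : 0 ≤ (inner ℂ v (eigenprojection Φ 1 1 v)).re := by
    refine nonneg_of_forall_nat_mul_add_nonneg (B := B) fun N => ?_
    have h1 := congrArg Complex.re (hs N)
    simp only [Complex.re_sum, Complex.add_re, Complex.mul_re, Complex.natCast_re,
      Complex.natCast_im, zero_mul, sub_zero] at h1
    have h2 : 0 ≤ ∑ n ∈ Finset.range N, (inner ℂ v ((Φ ^ n) 1 v)).re :=
      Finset.sum_nonneg fun n _ => (hΦ.pow n).re_inner_map_one_nonneg v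
    have h3 := (Complex.re_le_norm _).trans (hb N)
    linarith
  have him : (inner ℂ v (eigenprojection Φ 1 1 v)).im = 0 := by
    have h1 : ∀ N : ℕ, |N * (inner ℂ v (eigenprojection Φ 1 1 v)).im| ≤ B := by
      intro N
      have h1 := congrArg Complex.im (hs N)
      simp only [Complex.im_sum, Complex.add_im, Complex.mul_im, Complex.natCast_re,
        Complex.natCast_im, zero_mul, add_zero, (hΦ.pow _).im_inner_map_one,
        Finset.sum_const_zero] at h1
      rw [show (N : ℝ) * (inner ℂ v (eigenprojection Φ 1 1 v)).im = -(b N).im by linarith, abs_neg]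
      exact (Complex.abs_im_le_norm _).trans (hb N)
    refine le_antisymm ?_ ?_
    · have := nonneg_of_forall_nat_mul_add_nonneg
        (a := -(inner ℂ v (eigenprojection Φ 1 1 v)).im) (B := B)
        fun N => by linarith [(abs_le.mp (h1 N)).2]
      linarith
    · exact nonneg_of_forall_nat_mul_add_nonneg (B := B)
        fun N => by linarith [(abs_le.mp (h1 N)).1]
  have hc : inner ℂ (eigenprojection Φ 1 1 v) v = inner ℂ v (eigenprojection Φ 1 1 v) := by
    rw [← inner_conj_symm]
    exact Complex.conj_eq_iff_im.mpr him
  rw [hc]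
  refine ⟨?_, hre⟩
  apply Complex.ext
  · simp
  · simpa using him.symm

/-- The peripheral eigenvectors of a channel are supported on the range of `eigenprojection Φ 1 1`:
averaging the Cauchy-Schwarz inequality for the powers of `Φ` bounds their matrix coefficients. -/
theorem HasKrausForm.inner_eq_zero_of_eigenprojection_eq_zero {Φ : End ℂ (H →L[ℂ] H)}
    (hΦ : HasKrausForm Φ) {μ : ℂ} (hμ : ‖μ‖ = 1) {X : H →L[ℂ] H} (hX : Φ X = μ • X) {v : H}
    (hv : eigenprojection Φ 1 1 v = 0) (w : H) : inner ℂ v (X w) = 0 := by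
  have hpow : ∀ n : ℕ, (Φ ^ n) X = μ ^ n • X := by
    intro n
    induction n with
    | zero => simp
    | succ n ih => rw [pow_succ, Module.End.mul_apply, hX, map_smul, ih, smul_smul, pow_succ']
  have key : ∀ v w : H, ‖inner ℂ v (X w)‖ ≤ ‖X‖ / 2 *
      ((inner ℂ v (eigenprojection Φ 1 1 v)).re + (inner ℂ w (eigenprojection Φ 1 1 w)).re) := by
    intro v w
    obtain ⟨B, b, hb, hs⟩ := hΦ.exists_sum_pow_one v
    obtain ⟨B', b', hb', hs'⟩ := hΦ.exists_sum_pow_one w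
    rw [← sub_nonneg]
    refine nonneg_of_forall_nat_mul_add_nonneg (B := ‖X‖ / 2 * (B + B')) fun N => ?_
    have h1 : N * ‖inner ℂ v (X w)‖ ≤ ‖X‖ / 2 *
        (∑ n ∈ Finset.range N, (inner ℂ v ((Φ ^ n) 1 v)).re +
          ∑ n ∈ Finset.range N, (inner ℂ w ((Φ ^ n) 1 w)).re) := by
      rw [← Finset.sum_add_distrib, Finset.mul_sum]
      have : (N : ℝ) * ‖inner ℂ v (X w)‖ = ∑ n ∈ Finset.range N, ‖inner ℂ v (X w)‖ := by simp
      rw [this]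
      refine Finset.sum_le_sum fun n _ => ?_
      have h2 := (hΦ.pow n).norm_inner_le X v w
      rwa [hpow, smul_apply, inner_smul_right, norm_mul, norm_pow, hμ, one_pow, one_mul] at h2
    have h3 := congrArg Complex.re (hs N)
    have h4 := congrArg Complex.re (hs' N)
    simp only [Complex.re_sum, Complex.add_re, Complex.mul_re, Complex.natCast_re,
      Complex.natCast_im, zero_mul, sub_zero] at h3 h4
    rw [h3, h4] at h1
    have h5 : ‖X‖ / 2 * ((b N).re + (b' N).re) ≤ ‖X‖ / 2 * (B + B') := by
      gcongr
      · exact (Complex.re_le_norm _).trans (hb N)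
      · exact (Complex.re_le_norm _).trans (hb' N)
    nlinarith
  have h1 : ∀ N : ℕ, 0 ≤ N * (-‖inner ℂ v (X w)‖) +
      ‖X‖ / 2 * (inner ℂ w (eigenprojection Φ 1 1 w)).re := by
    intro N
    have h2 := key ((N : ℂ) • v) w
    rw [map_smul, hv, smul_zero, inner_zero_right, inner_smul_left, norm_mul] at h2
    simp only [Complex.conj_natCast, Complex.norm_natCast, Complex.zero_re, zero_add] at h2
    linarith
  have h4 := nonneg_of_forall_nat_mul_add_nonneg h1
  exact norm_eq_zero.mp (le_antisymm (by linarith) (norm_nonneg _))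

end Ergodic

/-! ### Compression to the support of the maximal fixed point -/

section Compression

variable {H : Type*} [NormedAddCommGroup H] [InnerProductSpace ℂ H] [CompleteSpace H]
  [FiniteDimensional ℂ H] {I : Type*} [Fintype I] [DecidableEq I]

/-- The operator `V * Y * V†` on `H`, for a matrix `Y` and an isometry `V` into `H`. -/
noncomputable def liftOp (V : EuclideanSpace ℂ I →ₗᵢ[ℂ] H) : Matrix I I ℂ →ₗ[ℂ] (H →L[ℂ] H) where
  toFun Y := V.toContinuousLinearMap ∘L (Matrix.toEuclideanCLM (𝕜 := ℂ) Y) ∘L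
    ContinuousLinearMap.adjoint V.toContinuousLinearMap
  map_add' X Y := by ext; simp
  map_smul' c X := by ext; simp

/-- The matrix of `V† * X * V`. -/
noncomputable def compress (V : EuclideanSpace ℂ I →ₗᵢ[ℂ] H) (X : H →L[ℂ] H) : Matrix I I ℂ :=
  (Matrix.toEuclideanCLM (𝕜 := ℂ) (n := I)).symm
    (ContinuousLinearMap.adjoint V.toContinuousLinearMap ∘L X ∘L V.toContinuousLinearMap)

theorem matrix_ext_of_toEuclideanCLM {Y Z : Matrix I I ℂ}
    (h : ∀ x, Matrix.toEuclideanCLM (𝕜 := ℂ) Y x = Matrix.toEuclideanCLM (𝕜 := ℂ) Z x) : Y = Z :=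
  EquivLike.injective (Matrix.toEuclideanCLM (𝕜 := ℂ) (n := I)) (ContinuousLinearMap.ext h)

variable (V : EuclideanSpace ℂ I →ₗᵢ[ℂ] H)

theorem adjoint_apply_apply (x : EuclideanSpace ℂ I) :
    ContinuousLinearMap.adjoint V.toContinuousLinearMap (V x) = x := by
  refine ext_inner_left ℂ fun y => ?_
  rw [ContinuousLinearMap.adjoint_inner_right]
  exact V.inner_map_map y x

theorem liftOp_apply (Y : Matrix I I ℂ) (v : H) :
    liftOp V Y v = V (Matrix.toEuclideanCLM (𝕜 := ℂ) Y
      (ContinuousLinearMap.adjoint V.toContinuousLinearMap v)) := rfl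

theorem toEuclideanCLM_compress_apply (X : H →L[ℂ] H) (x : EuclideanSpace ℂ I) :
    Matrix.toEuclideanCLM (𝕜 := ℂ) (compress V X) x =
      ContinuousLinearMap.adjoint V.toContinuousLinearMap (X (V x)) := by
  rw [compress, StarAlgEquiv.apply_symm_apply]
  rfl

theorem compress_liftOp (Y : Matrix I I ℂ) : compress V (liftOp V Y) = Y := by
  refine matrix_ext_of_toEuclideanCLM fun x => ?_
  rw [toEuclideanCLM_compress_apply, liftOp_apply, adjoint_apply_apply, adjoint_apply_apply]

theorem liftOp_injective : Function.Injective (liftOp V) :=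
  Function.LeftInverse.injective (compress_liftOp V)

theorem liftOp_mul (Y Z : Matrix I I ℂ) : liftOp V (Y * Z) = liftOp V Y * liftOp V Z := by
  ext1 v
  rw [mul_apply_eq_comp, liftOp_apply, liftOp_apply, liftOp_apply,
    adjoint_apply_apply, map_mul]
  rfl

theorem liftOp_conjTranspose (Y : Matrix I I ℂ) : liftOp V Yᴴ = star (liftOp V Y) := by
  have h : Matrix.toEuclideanCLM (𝕜 := ℂ) Yᴴ =
      ContinuousLinearMap.adjoint (Matrix.toEuclideanCLM (𝕜 := ℂ) Y) :=
    map_star (Matrix.toEuclideanCLM (𝕜 := ℂ) (n := I)) Y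
  rw [ContinuousLinearMap.star_eq_adjoint, liftOp, LinearMap.coe_mk, AddHom.coe_mk, h]
  simp only [ContinuousLinearMap.adjoint_comp, ContinuousLinearMap.adjoint_adjoint]
  rfl

theorem compress_star (X : H →L[ℂ] H) : compress V (star X) = (compress V X)ᴴ := by
  apply EquivLike.injective (Matrix.toEuclideanCLM (𝕜 := ℂ) (n := I))
  have h : Matrix.toEuclideanCLM (𝕜 := ℂ) (compress V X)ᴴ =
      star (Matrix.toEuclideanCLM (𝕜 := ℂ) (compress V X)) :=
    map_star (Matrix.toEuclideanCLM (𝕜 := ℂ) (n := I)) _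
  rw [h, compress, compress, StarAlgEquiv.apply_symm_apply, StarAlgEquiv.apply_symm_apply,
    ContinuousLinearMap.star_eq_adjoint, ContinuousLinearMap.star_eq_adjoint]
  simp only [ContinuousLinearMap.adjoint_comp, ContinuousLinearMap.adjoint_adjoint]
  rfl

/-- The completely positive map `Y ↦ ∑ i, L i * Y * (L i)ᴴ` of a matrix algebra. -/
def krausMap {ι : Type*} [Fintype ι] (L : ι → Matrix I I ℂ) : End ℂ (Matrix I I ℂ) where
  toFun Y := ∑ i, L i * Y * (L i)ᴴ
  map_add' X Y := by simp [mul_add, add_mul, Finset.sum_add_distrib]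
  map_smul' c X := by simp [Finset.smul_sum]

theorem krausMap_apply {ι : Type*} [Fintype ι] (L : ι → Matrix I I ℂ) (Y : Matrix I I ℂ) :
    krausMap L Y = ∑ i, L i * Y * (L i)ᴴ := rfl

theorem krausMap_conjTranspose {ι : Type*} [Fintype ι] (L : ι → Matrix I I ℂ) (Y : Matrix I I ℂ) :
    krausMap L Yᴴ = (krausMap L Y)ᴴ := by
  simp [krausMap_apply, Matrix.conjTranspose_sum, Matrix.mul_assoc]

theorem apply_eq_zero_of_inner_eq_zero {T : H →L[ℂ] H} (hT : T.IsPositive) {v : H}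
    (hv : inner ℂ v (T v) = 0) : T v = 0 := by
  obtain ⟨S, rfl⟩ := exists_eq_star_mul_self_of_nonneg
    ((ContinuousLinearMap.nonneg_iff_isPositive T).mpr hT)
  rw [mul_apply_eq_comp, ContinuousLinearMap.star_eq_adjoint,
    ContinuousLinearMap.adjoint_inner_right, inner_self_eq_zero] at hv
  rw [mul_apply_eq_comp, hv, map_zero]

/-- A vector orthogonal to the range of a positive operator is in its kernel. -/
theorem apply_eq_zero_of_adjoint_eq_zero {V : EuclideanSpace ℂ I →ₗᵢ[ℂ] H} {Q : H →L[ℂ] H}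
    (hQ : Q.IsPositive) (hV : LinearMap.range V.toLinearMap = LinearMap.range (Q : H →ₗ[ℂ] H))
    {v : H} (hv : ContinuousLinearMap.adjoint V.toContinuousLinearMap v = 0) : Q v = 0 := by
  refine ext_inner_right ℂ fun z => ?_
  have hs : inner ℂ (Q v) z = inner ℂ v (Q z) := hQ.isSymmetric v z
  obtain ⟨x, hx⟩ : Q z ∈ LinearMap.range V.toLinearMap := hV ▸ ⟨z, rfl⟩
  have h2 : inner ℂ (ContinuousLinearMap.adjoint V.toContinuousLinearMap v) x = 0 := by
    rw [hv, inner_zero_left]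
  rw [ContinuousLinearMap.adjoint_inner_left] at h2
  rw [hs, inner_zero_left, ← hx]
  exact h2

theorem adjoint_eq_zero_of_apply_eq_zero {V : EuclideanSpace ℂ I →ₗᵢ[ℂ] H} {Q : H →L[ℂ] H}
    (hQ : Q.IsPositive) (hV : LinearMap.range V.toLinearMap = LinearMap.range (Q : H →ₗ[ℂ] H))
    {v : H} (hv : Q v = 0) : ContinuousLinearMap.adjoint V.toContinuousLinearMap v = 0 := by
  refine ext_inner_right ℂ fun z => ?_
  rw [ContinuousLinearMap.adjoint_inner_left, inner_zero_left]
  obtain ⟨x, hx⟩ : V z ∈ LinearMap.range (Q : H →ₗ[ℂ] H) := hV ▸ ⟨z, rfl⟩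
  have hs : inner ℂ (Q v) x = inner ℂ v (Q x) := hQ.isSymmetric v x
  rw [hv, inner_zero_left] at hs
  exact (congrArg (inner ℂ v) hx.symm).trans hs.symm

theorem apply_adjoint_of_inner_eq_zero {V : EuclideanSpace ℂ I →ₗᵢ[ℂ] H} {Q : H →L[ℂ] H}
    (hQ : Q.IsPositive) (hV : LinearMap.range V.toLinearMap = LinearMap.range (Q : H →ₗ[ℂ] H))
    {u : H} (h : ∀ v, Q v = 0 → inner ℂ v u = 0) :
    V (ContinuousLinearMap.adjoint V.toContinuousLinearMap u) = u := by
  set y := ContinuousLinearMap.adjoint V.toContinuousLinearMap u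
  have h1 : ContinuousLinearMap.adjoint V.toContinuousLinearMap (u - V y) = 0 := by
    rw [map_sub, adjoint_apply_apply, sub_self]
  have h2 := h _ (apply_eq_zero_of_adjoint_eq_zero hQ hV h1)
  have h3 : inner ℂ (u - V y) (V y) = 0 := by
    have := ContinuousLinearMap.adjoint_inner_left V.toContinuousLinearMap y (u - V y)
    rw [h1, inner_zero_left] at this
    exact this.symm
  have h4 : inner ℂ (u - V y) (u - V y) = 0 := by
    rw [inner_sub_right, h2, h3, sub_zero]
  exact (sub_eq_zero.mp (inner_self_eq_zero.mp h4)).symm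

/-- An operator which, together with its adjoint, takes values in the range of `V` is the lift of
its compression. -/
theorem liftOp_compress_of_inner_eq_zero {V : EuclideanSpace ℂ I →ₗᵢ[ℂ] H} {Q : H →L[ℂ] H}
    (hQ : Q.IsPositive) (hV : LinearMap.range V.toLinearMap = LinearMap.range (Q : H →ₗ[ℂ] H))
    {X : H →L[ℂ] H} (h : ∀ v w, Q v = 0 → inner ℂ v (X w) = 0)
    (h' : ∀ v w, Q v = 0 → inner ℂ v (star X w) = 0) : liftOp V (compress V X) = X := by
  ext1 v
  rw [liftOp_apply, toEuclideanCLM_compress_apply,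
    apply_adjoint_of_inner_eq_zero hQ hV fun w hw => h w _ hw]
  set p := V (ContinuousLinearMap.adjoint V.toContinuousLinearMap v)
  have h1 : ContinuousLinearMap.adjoint V.toContinuousLinearMap (p - v) = 0 := by
    rw [map_sub, adjoint_apply_apply, sub_self]
  rw [← sub_eq_zero, ← map_sub]
  refine ext_inner_right ℂ fun w => ?_
  have h2 := h' _ w (apply_eq_zero_of_adjoint_eq_zero hQ hV h1)
  rw [ContinuousLinearMap.star_eq_adjoint, ContinuousLinearMap.adjoint_inner_right] at h2
  rw [h2, inner_zero_left]

variable {V}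

/-- The restriction of a channel to operators supported on the range of the maximal fixed point
`eigenprojection Φ 1 1` is a channel with an invertible fixed point `ω`, and it carries all
peripheral eigenvectors. -/
theorem HasKrausForm.exists_compression {Φ : End ℂ (H →L[ℂ] H)} (hΦ : HasKrausForm Φ)
    (hV : LinearMap.range V.toLinearMap =
      LinearMap.range (eigenprojection Φ 1 (1 : H →L[ℂ] H) : H →ₗ[ℂ] H)) :
    ∃ (ι : Type) (_ : Fintype ι) (L : ι → Matrix I I ℂ) (ω : Matrix I I ℂ),
      ∑ i, (L i)ᴴ * L i = 1 ∧ ω.PosDef ∧ krausMap L ω = ω ∧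
      (∀ Y, Φ (liftOp V Y) = liftOp V (krausMap L Y)) ∧ liftOp V ω = eigenprojection Φ 1 1 ∧
      attractor Φ = (peripheralSpan (krausMap L)).map (liftOp V) := by
  have hQ := hΦ.isPositive_eigenprojection_one
  have hfix := (hΦ.eigenprojection_one_spec 1).1
  have hsupp := fun (μ : ℂ) (hμ : ‖μ‖ = 1) (X : H →L[ℂ] H) (hX : Φ X = μ • X) =>
    liftOp_compress_of_inner_eq_zero (X := X) hQ hV
      (fun v w hv => hΦ.inner_eq_zero_of_eigenprojection_eq_zero hμ hX hv w)
      (fun v w hv => hΦ.inner_eq_zero_of_eigenprojection_eq_zero (μ := star μ) (by simpa using hμ)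
        (by rw [hΦ.apply_star, hX, star_smul]) hv w)
  obtain ⟨ι, _, K, hK, hK1⟩ := id hΦ
  set Q := eigenprojection Φ 1 (1 : H →L[ℂ] H)
  -- the range of `V` is invariant under the Kraus operators
  have hinv : ∀ i x, V (ContinuousLinearMap.adjoint V.toContinuousLinearMap (K i (V x))) =
      K i (V x) := by
    intro i x
    refine apply_adjoint_of_inner_eq_zero hQ hV fun v hv => ?_
    have h1 : inner ℂ v (Q v) = 0 := by rw [hv, inner_zero_right]
    rw [← hfix, hK, inner_kraus_apply] at h1
    have h2 := (Finset.sum_eq_zero_iff_of_nonneg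
      (fun j _ => hQ.inner_nonneg_right (star (K j) v))).mp h1 i (Finset.mem_univ i)
    have h3 := adjoint_eq_zero_of_apply_eq_zero hQ hV (apply_eq_zero_of_inner_eq_zero hQ h2)
    have h4 := ContinuousLinearMap.adjoint_inner_left V.toContinuousLinearMap x (star (K i) v)
    rw [h3, inner_zero_left, ContinuousLinearMap.star_eq_adjoint,
      ContinuousLinearMap.adjoint_inner_left] at h4
    exact h4.symm
  let L : ι → Matrix I I ℂ := fun i => compress V (K i)
  have hKV : ∀ i x, K i (V x) = V (Matrix.toEuclideanCLM (𝕜 := ℂ) (L i) x) := by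
    intro i x
    rw [toEuclideanCLM_compress_apply, hinv]
  have hLs : ∀ i x, ContinuousLinearMap.adjoint V.toContinuousLinearMap (star (K i) x) =
      Matrix.toEuclideanCLM (𝕜 := ℂ) (L i)ᴴ
        (ContinuousLinearMap.adjoint V.toContinuousLinearMap x) := by
    intro i x
    have h : Matrix.toEuclideanCLM (𝕜 := ℂ) (L i)ᴴ =
      ContinuousLinearMap.adjoint (Matrix.toEuclideanCLM (𝕜 := ℂ) (L i)) :=
      map_star (Matrix.toEuclideanCLM (𝕜 := ℂ) (n := I)) _
    refine ext_inner_right ℂ fun z => ?_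
    rw [h, ContinuousLinearMap.adjoint_inner_left, ContinuousLinearMap.star_eq_adjoint,
      ContinuousLinearMap.adjoint_inner_left, ContinuousLinearMap.adjoint_inner_left]
    erw [ContinuousLinearMap.adjoint_inner_left]
    exact congrArg (inner ℂ x) (hKV i z)
  have hlift : ∀ Y, Φ (liftOp V Y) = liftOp V (krausMap L Y) := by
    intro Y
    rw [hK, krausMap_apply, map_sum]
    refine Finset.sum_congr rfl fun i _ => ?_
    ext1 v
    rw [mul_assoc, mul_assoc]
    simp only [mul_apply_eq_comp, liftOp_apply, hKV, hLs, map_mul]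
  have hω : liftOp V (compress V Q) = Q := by
    refine hsupp 1 (by simp) Q (by rw [hfix, one_smul])
  refine ⟨ι, inferInstance, L, compress V Q, ?_, ?_, ?_, hlift, hω, ?_⟩
  · refine matrix_ext_of_toEuclideanCLM fun x => ?_
    have h1 : V x = (∑ i, star (K i) * K i) (V x) := by rw [hK1]; rfl
    rw [sum_apply] at h1
    have h2 := congrArg (ContinuousLinearMap.adjoint V.toContinuousLinearMap) h1
    rw [adjoint_apply_apply, map_sum] at h2
    rw [map_sum, map_one, one_apply_eq_self, sum_apply]
    conv_rhs => rw [h2]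
    refine Finset.sum_congr rfl fun i _ => ?_
    rw [mul_apply_eq_comp, hKV, hLs, adjoint_apply_apply, map_mul]
    rfl
  · have hherm : (compress V Q)ᴴ = compress V Q := by
      rw [← compress_star, hQ.isSelfAdjoint.star_eq]
    refine Matrix.PosDef.of_dotProduct_mulVec_pos hherm fun x hx => ?_
    have h1 : star x ⬝ᵥ compress V Q *ᵥ x =
        inner ℂ (V (WithLp.toLp 2 x)) (Q (V (WithLp.toLp 2 x))) := by
      have h2 := ContinuousLinearMap.adjoint_inner_right V.toContinuousLinearMap
        (WithLp.toLp 2 x) (Q (V (WithLp.toLp 2 x)))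
      rw [← toEuclideanCLM_compress_apply] at h2
      refine Eq.trans ?_ h2
      rw [EuclideanSpace.inner_eq_star_dotProduct, dotProduct_comm]
      rfl
    rw [h1]
    refine lt_of_le_of_ne (hQ.inner_nonneg_right _) fun h0 => hx ?_
    have h3 := adjoint_eq_zero_of_apply_eq_zero hQ hV (apply_eq_zero_of_inner_eq_zero hQ h0.symm)
    rw [adjoint_apply_apply] at h3
    exact congrArg WithLp.ofLp h3
  · apply liftOp_injective V
    rw [← hlift, hω, hfix]
  · rw [attractor_eq_peripheralSpan]
    exact map_peripheralSpan (liftOp V) (liftOp_injective V) hlift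
      fun μ Y hμ hY => ⟨_, hsupp μ hμ Y hY⟩

end Compression

/-! ### The star algebra of a channel with an invertible fixed point -/

section FaithfulChannel

variable {I : Type*} [Fintype I] [DecidableEq I] {ι : Type*} [Fintype ι]

theorem trace_mul_mul_conjTranspose_nonneg {ω : Matrix I I ℂ} (hω : ω.PosDef) (A : Matrix I I ℂ) :
    0 ≤ (A * ω * Aᴴ).trace :=
  (hω.posSemidef.mul_mul_conjTranspose_same A).trace_nonneg

open scoped MatrixOrder in
theorem eq_zero_of_trace_mul_mul_conjTranspose {ω : Matrix I I ℂ} (hω : ω.PosDef)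
    {A : Matrix I I ℂ} (h : (A * ω * Aᴴ).trace = 0) : A = 0 := by
  obtain ⟨B, hB⟩ := CStarAlgebra.nonneg_iff_eq_star_mul_self.mp hω.posSemidef.nonneg
  rw [Matrix.star_eq_conjTranspose] at hB
  have h1 : A * ω * Aᴴ = (A * Bᴴ) * (A * Bᴴ)ᴴ := by
    rw [Matrix.conjTranspose_mul, Matrix.conjTranspose_conjTranspose, hB]
    simp only [Matrix.mul_assoc]
  rw [h1, Matrix.trace_mul_conjTranspose_self_eq_zero_iff] at h
  have h2 : A * ω = 0 := by rw [hB, ← Matrix.mul_assoc, h, Matrix.zero_mul]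
  have hu := (Matrix.isUnit_iff_isUnit_det ω).mp hω.isUnit
  rw [← Matrix.mul_nonsing_inv_cancel_right ω A hu, h2, Matrix.zero_mul]

theorem eq_zero_of_trace_sum_eq_zero {ω : Matrix I I ℂ} (hω : ω.PosDef) {A : ι → Matrix I I ℂ}
    (h : ∑ i, (A i * ω * (A i)ᴴ).trace = 0) (i : ι) : A i = 0 :=
  eq_zero_of_trace_mul_mul_conjTranspose hω <|
    (Finset.sum_eq_zero_iff_of_nonneg
      fun j _ => trace_mul_mul_conjTranspose_nonneg hω (A j)).mp h i (Finset.mem_univ i)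

theorem trace_krausMap {L : ι → Matrix I I ℂ} (hL : ∑ i, (L i)ᴴ * L i = 1) (Y : Matrix I I ℂ) :
    (krausMap L Y).trace = Y.trace := by
  have h : Y = (∑ i, (L i)ᴴ * L i) * Y := by rw [hL, Matrix.one_mul]
  conv_rhs => rw [h]
  rw [krausMap_apply, Matrix.trace_sum, Finset.sum_mul, Matrix.trace_sum]
  refine Finset.sum_congr rfl fun i _ => ?_
  rw [Matrix.trace_mul_comm, ← Matrix.mul_assoc]

theorem mul_star_self_of_norm_eq_one {μ : ℂ} (hμ : ‖μ‖ = 1) : μ * star μ = 1 := by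
  rw [RCLike.star_def, Complex.mul_conj, Complex.normSq_eq_norm_sq, hμ]; simp

/-- A peripheral eigenvector, divided by the fixed point `ω`, commutes with the Kraus operators up
to the eigenvalue: the commutator defects, weighted with `ω`, have total trace zero. -/
theorem kraus_mul_of_krausMap_eq {L : ι → Matrix I I ℂ} (hL : ∑ i, (L i)ᴴ * L i = 1)
    {ω : Matrix I I ℂ} (hω : ω.PosDef) (hfix : krausMap L ω = ω) {μ : ℂ} (hμ : ‖μ‖ = 1)
    {Z : Matrix I I ℂ} (hZ : krausMap L (Z * ω) = μ • (Z * ω)) (i : ι) :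
    L i * Z = μ • (Z * L i) := by
  have hμ' := mul_star_self_of_norm_eq_one hμ
  have hμ'' : star μ * μ = 1 := by rw [mul_comm, hμ']
  have hωh : ωᴴ = ω := hω.isHermitian
  have hZ' : krausMap L (ω * Zᴴ) = star μ • (ω * Zᴴ) := by
    have h := krausMap_conjTranspose L (Z * ω)
    rw [hZ, Matrix.conjTranspose_smul, Matrix.conjTranspose_mul, hωh] at h
    exact h
  have hsum : ∑ i, (μ • (Z * L i) - L i * Z) * ω * (μ • (Z * L i) - L i * Z)ᴴ =
      krausMap L (Z * ω * Zᴴ) - Z * ω * Zᴴ := by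
    have hterm : ∀ i, (μ • (Z * L i) - L i * Z) * ω * (μ • (Z * L i) - L i * Z)ᴴ =
        Z * (L i * ω * (L i)ᴴ) * Zᴴ - μ • (Z * (L i * (ω * Zᴴ) * (L i)ᴴ)) -
          star μ • ((L i * (Z * ω) * (L i)ᴴ) * Zᴴ) + L i * (Z * ω * Zᴴ) * (L i)ᴴ := by
      intro i
      simp only [Matrix.conjTranspose_sub, Matrix.conjTranspose_smul, Matrix.conjTranspose_mul,
        sub_mul, mul_sub, smul_mul_assoc, mul_smul_comm, smul_sub, smul_smul,
        hμ'', one_smul, Matrix.mul_assoc]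
      abel
    simp only [hterm]
    rw [Finset.sum_add_distrib, Finset.sum_sub_distrib, Finset.sum_sub_distrib, ← Finset.smul_sum,
      ← Finset.smul_sum, ← Finset.sum_mul, ← Finset.mul_sum, ← Finset.mul_sum, ← Finset.sum_mul,
      ← krausMap_apply, ← krausMap_apply, ← krausMap_apply, ← krausMap_apply, hfix, hZ, hZ',
      mul_smul_comm, smul_mul_assoc, smul_smul, smul_smul, mul_comm (star μ) μ, hμ', one_smul,
      one_smul, Matrix.mul_assoc]
    abel
  have h0 := eq_zero_of_trace_sum_eq_zero hω
    (A := fun i => μ • (Z * L i) - L i * Z) (by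
      rw [← Matrix.trace_sum, hsum, Matrix.trace_sub, trace_krausMap hL, sub_self]) i
  exact (sub_eq_zero.mp h0).symm

/-- The relation `L i * Z = μ • (Z * L i)` passes to the adjoint of `Z`, by the analogous
computation for the dual channel. -/
theorem kraus_mul_conjTranspose {L : ι → Matrix I I ℂ} (hL : ∑ i, (L i)ᴴ * L i = 1)
    {ω : Matrix I I ℂ} (hω : ω.PosDef) (hfix : krausMap L ω = ω) {μ : ℂ} (hμ : ‖μ‖ = 1)
    {Z : Matrix I I ℂ} (hZ : ∀ i, L i * Z = μ • (Z * L i)) (i : ι) :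
    L i * Zᴴ = star μ • (Zᴴ * L i) := by
  have hμ' := mul_star_self_of_norm_eq_one hμ
  have hμ'' : star μ * μ = 1 := by rw [mul_comm, hμ']
  have hZ2 : ∀ i, Z * L i = star μ • (L i * Z) := by
    intro i; rw [hZ, smul_smul, hμ'', one_smul]
  have hD : ∑ i, (L i)ᴴ * (Z * L i) = star μ • Z := by
    simp only [hZ2, mul_smul_comm, ← Matrix.mul_assoc]
    rw [← Finset.smul_sum, ← Finset.sum_mul, hL, Matrix.one_mul]
  have hD' : ∑ i, (L i)ᴴ * (Zᴴ * L i) = μ • Zᴴ := by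
    have := congrArg Matrix.conjTranspose hD
    simpa [Matrix.conjTranspose_sum, Matrix.mul_assoc] using this
  have hsum : ∑ i, (Zᴴ * L i - μ • (L i * Zᴴ))ᴴ * (Zᴴ * L i - μ • (L i * Zᴴ)) =
      ∑ i, (L i)ᴴ * (Z * Zᴴ) * L i - Z * Zᴴ := by
    have hterm : ∀ i, (Zᴴ * L i - μ • (L i * Zᴴ))ᴴ * (Zᴴ * L i - μ • (L i * Zᴴ)) =
        (L i)ᴴ * (Z * Zᴴ) * L i - μ • ((L i)ᴴ * (Z * L i) * Zᴴ) -
          star μ • (Z * ((L i)ᴴ * (Zᴴ * L i))) + Z * ((L i)ᴴ * L i) * Zᴴ := by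
      intro i
      simp only [Matrix.conjTranspose_sub, Matrix.conjTranspose_smul, Matrix.conjTranspose_mul,
        Matrix.conjTranspose_conjTranspose, sub_mul, mul_sub, smul_mul_assoc, mul_smul_comm,
        smul_sub, smul_smul, hμ', one_smul, Matrix.mul_assoc]
      abel
    simp only [hterm]
    rw [Finset.sum_add_distrib, Finset.sum_sub_distrib, Finset.sum_sub_distrib, ← Finset.smul_sum,
      ← Finset.smul_sum, ← Finset.sum_mul, ← Finset.mul_sum, ← Finset.sum_mul, ← Finset.mul_sum,
      hL, hD, hD', mul_smul_comm, smul_mul_assoc, smul_smul, smul_smul, hμ', hμ'', one_smul,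
      Matrix.mul_one]
    abel
  have h0 := eq_zero_of_trace_sum_eq_zero hω
    (A := fun i => Zᴴ * L i - μ • (L i * Zᴴ)) (by
      have h1 : ∀ A : Matrix I I ℂ, (A * ω * Aᴴ).trace = (Aᴴ * A * ω).trace := by
        intro A
        rw [Matrix.trace_mul_comm, ← Matrix.mul_assoc]
      simp only [h1]
      rw [← Matrix.trace_sum, ← Finset.sum_mul, hsum, sub_mul, Matrix.trace_sub, Finset.sum_mul,
        Matrix.trace_sum]
      have h2 : ∀ i, ((L i)ᴴ * (Z * Zᴴ) * L i * ω).trace =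
          (Z * Zᴴ * (L i * ω * (L i)ᴴ)).trace := by
        intro i
        rw [Matrix.mul_assoc, Matrix.mul_assoc, Matrix.trace_mul_comm]
        simp only [Matrix.mul_assoc]
      simp only [h2]
      rw [← Matrix.trace_sum, ← Finset.mul_sum, ← krausMap_apply, hfix, sub_self]) i
  rw [sub_eq_zero.mp h0, smul_smul, hμ'', one_smul]

/-- The channel, read on the operators `Z` with `X = Z * ω` in place of `X`. -/
noncomputable def twistedMap (L : ι → Matrix I I ℂ) (ω : Matrix I I ℂ) : End ℂ (Matrix I I ℂ) :=
  LinearMap.mulRight ℂ ω⁻¹ ∘ₗ krausMap L ∘ₗ LinearMap.mulRight ℂ ω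

theorem twistedMap_mul {L : ι → Matrix I I ℂ} {ω : Matrix I I ℂ} (hω : ω.PosDef)
    (Z : Matrix I I ℂ) : twistedMap L ω Z * ω = krausMap L (Z * ω) := by
  have hu := (Matrix.isUnit_iff_isUnit_det ω).mp hω.isUnit
  simp only [twistedMap, LinearMap.comp_apply, LinearMap.mulRight_apply]
  exact Matrix.nonsing_inv_mul_cancel_right ω _ hu

theorem mul_right_injective_of_posDef {ω : Matrix I I ℂ} (hω : ω.PosDef) :
    Function.Injective fun Z : Matrix I I ℂ => Z * ω :=
  fun _ _ h => hω.isUnit.mul_right_cancel h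

theorem twistedMap_eq_smul_iff {L : ι → Matrix I I ℂ} (hL : ∑ i, (L i)ᴴ * L i = 1)
    {ω : Matrix I I ℂ} (hω : ω.PosDef) (hfix : krausMap L ω = ω) {μ : ℂ} (hμ : ‖μ‖ = 1)
    {Z : Matrix I I ℂ} : twistedMap L ω Z = μ • Z ↔ ∀ i, L i * Z = μ • (Z * L i) := by
  constructor
  · intro h
    refine kraus_mul_of_krausMap_eq hL hω hfix hμ ?_
    rw [← twistedMap_mul hω, h, smul_mul_assoc]
  · intro h
    apply mul_right_injective_of_posDef hω
    simp only
    rw [twistedMap_mul hω, krausMap_apply]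
    have h1 : ∀ i, L i * (Z * ω) * (L i)ᴴ = μ • (Z * (L i * ω * (L i)ᴴ)) := by
      intro i
      rw [← Matrix.mul_assoc, h]
      simp only [smul_mul_assoc, Matrix.mul_assoc]
    simp only [h1]
    rw [← Finset.smul_sum, ← Finset.mul_sum, ← krausMap_apply, hfix, smul_mul_assoc]

theorem peripheralSpan_krausMap {L : ι → Matrix I I ℂ} {ω : Matrix I I ℂ} (hω : ω.PosDef) :
    peripheralSpan (krausMap L) =
      (peripheralSpan (twistedMap L ω)).map (LinearMap.mulRight ℂ ω) := by
  have hu := (Matrix.isUnit_iff_isUnit_det ω).mp hω.isUnit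
  refine map_peripheralSpan _ (mul_right_injective_of_posDef hω) (fun Z => ?_) fun μ Y _ _ => ?_
  · exact (twistedMap_mul hω Z).symm
  · exact ⟨Y * ω⁻¹, Matrix.nonsing_inv_mul_cancel_right ω _ hu⟩

theorem twistedMap_mul_mem {L : ι → Matrix I I ℂ} (hL : ∑ i, (L i)ᴴ * L i = 1)
    {ω : Matrix I I ℂ} (hω : ω.PosDef) (hfix : krausMap L ω = ω) {Z W : Matrix I I ℂ}
    (hZ : Z ∈ peripheralSpan (twistedMap L ω)) (hW : W ∈ peripheralSpan (twistedMap L ω)) :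
    Z * W ∈ peripheralSpan (twistedMap L ω) ∧
      twistedMap L ω (Z * W) = twistedMap L ω Z * twistedMap L ω W := by
  refine peripheralSpan_induction (p := fun Z => Z * W ∈ peripheralSpan (twistedMap L ω) ∧
      twistedMap L ω (Z * W) = twistedMap L ω Z * twistedMap L ω W)
    (fun μ Z hμ hZ => ?_) (fun Z Z' h h' => ?_) hZ
  · refine peripheralSpan_induction (p := fun W => Z * W ∈ peripheralSpan (twistedMap L ω) ∧
      twistedMap L ω (Z * W) = twistedMap L ω Z * twistedMap L ω W)
      (fun ν W hν hW => ?_) (fun W W' h h' => ?_) hW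
    · have hμν : ‖μ * ν‖ = 1 := by rw [norm_mul, hμ, hν, one_mul]
      have h1 : twistedMap L ω (Z * W) = (μ * ν) • (Z * W) := by
        rw [twistedMap_eq_smul_iff hL hω hfix hμν]
        intro i
        rw [← Matrix.mul_assoc, (twistedMap_eq_smul_iff hL hω hfix hμ).mp hZ i, smul_mul_assoc,
          Matrix.mul_assoc, (twistedMap_eq_smul_iff hL hω hfix hν).mp hW i, mul_smul_comm,
          smul_smul, Matrix.mul_assoc]
      refine ⟨mem_peripheralSpan hμν h1, ?_⟩
      rw [h1, hZ, hW, smul_mul_smul_comm]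
    · rw [mul_add, map_add, map_add, mul_add, h.2, h'.2]
      exact ⟨Submodule.add_mem _ h.1 h'.1, rfl⟩
  · rw [add_mul, map_add, map_add, add_mul, h.2, h'.2]
    exact ⟨Submodule.add_mem _ h.1 h'.1, rfl⟩

theorem twistedMap_conjTranspose_mem {L : ι → Matrix I I ℂ} (hL : ∑ i, (L i)ᴴ * L i = 1)
    {ω : Matrix I I ℂ} (hω : ω.PosDef) (hfix : krausMap L ω = ω) {Z : Matrix I I ℂ}
    (hZ : Z ∈ peripheralSpan (twistedMap L ω)) : Zᴴ ∈ peripheralSpan (twistedMap L ω) ∧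
      twistedMap L ω Zᴴ = (twistedMap L ω Z)ᴴ := by
  refine peripheralSpan_induction (p := fun Z => Zᴴ ∈ peripheralSpan (twistedMap L ω) ∧
      twistedMap L ω Zᴴ = (twistedMap L ω Z)ᴴ) (fun μ Z hμ hZ => ?_) (fun Z Z' h h' => ?_) hZ
  · have hμ' : ‖star μ‖ = 1 := by simpa using hμ
    have h1 : twistedMap L ω Zᴴ = star μ • Zᴴ :=
      (twistedMap_eq_smul_iff hL hω hfix hμ').mpr
        (kraus_mul_conjTranspose hL hω hfix hμ ((twistedMap_eq_smul_iff hL hω hfix hμ).mp hZ))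
    exact ⟨mem_peripheralSpan hμ' h1, by rw [h1, hZ, Matrix.conjTranspose_smul]⟩
  · rw [Matrix.conjTranspose_add, map_add, map_add, Matrix.conjTranspose_add, h.2, h'.2]
    exact ⟨Submodule.add_mem _ h.1 h'.1, rfl⟩

theorem twistedMap_one {L : ι → Matrix I I ℂ} (hL : ∑ i, (L i)ᴴ * L i = 1)
    {ω : Matrix I I ℂ} (hω : ω.PosDef) (hfix : krausMap L ω = ω) : twistedMap L ω 1 = 1 := by
  have := (twistedMap_eq_smul_iff hL hω hfix (μ := 1) (Z := 1) (by simp)).mpr (by simp)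
  rwa [one_smul] at this

/-- The peripheral eigenvectors, divided by the invertible fixed point `ω`, span a star algebra. -/
noncomputable def peripheralAlgebra {L : ι → Matrix I I ℂ} (hL : ∑ i, (L i)ᴴ * L i = 1)
    {ω : Matrix I I ℂ} (hω : ω.PosDef) (hfix : krausMap L ω = ω) :
    StarSubalgebra ℂ (Matrix I I ℂ) where
  carrier := peripheralSpan (twistedMap L ω)
  mul_mem' hZ hW := (twistedMap_mul_mem hL hω hfix hZ hW).1
  add_mem' hZ hW := Submodule.add_mem _ hZ hW
  algebraMap_mem' c := by
    rw [Algebra.algebraMap_eq_smul_one]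
    refine Submodule.smul_mem _ _ (mem_peripheralSpan (μ := 1) (by simp) ?_)
    rw [twistedMap_one hL hω hfix, one_smul]
  star_mem' hZ := (twistedMap_conjTranspose_mem hL hω hfix hZ).1

end FaithfulChannel

/-! ### Star subalgebras of matrix algebras -/

section StarSubalgebra

variable {I : Type*} [Fintype I] [DecidableEq I]

/-- A minimal projection of a star subalgebra: a nonzero orthogonal projection that dominates no
other nonzero projection of the algebra. -/
structure IsMinimalProjection (N : StarSubalgebra ℂ (Matrix I I ℂ)) (e : Matrix I I ℂ) : Prop where
  mem : e ∈ N
  isStarProjection : IsStarProjection e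
  ne_zero : e ≠ 0
  eq_of_mul_eq : ∀ q ∈ N, IsStarProjection q → e * q = q → q ≠ 0 → q = e

variable {N : StarSubalgebra ℂ (Matrix I I ℂ)} {e f : Matrix I I ℂ}

theorem IsMinimalProjection.mul_self (he : IsMinimalProjection N e) : e * e = e :=
  he.isStarProjection.isIdempotentElem

theorem IsMinimalProjection.conjTranspose_eq (he : IsMinimalProjection N e) : eᴴ = e :=
  he.isStarProjection.isSelfAdjoint

theorem isStarProjection_iff_matrix {q : Matrix I I ℂ} :
    IsStarProjection q ↔ q * q = q ∧ qᴴ = q :=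
  ⟨fun h => ⟨h.isIdempotentElem, h.isSelfAdjoint⟩, fun h => ⟨h.1, h.2⟩⟩

/-- The spectral projection of `T` at a nonzero eigenvalue lies in the algebra and below `e`, so
that it equals `e`. -/
theorem IsMinimalProjection.exists_smul_of_isSelfAdjoint (he : IsMinimalProjection N e)
    {T : Matrix I I ℂ} (hT : T ∈ N) (hs : IsSelfAdjoint T) (heT : e * T = T) :
    ∃ c : ℂ, T = c • e := by
  by_cases h0 : ∀ x ∈ spectrum ℝ T, x = 0
  · refine ⟨0, ?_⟩
    have h1 : cfc (fun x : ℝ => x) T = cfc (fun _ : ℝ => (0 : ℝ)) T :=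
      cfc_congr fun x hx => h0 x hx
    rw [cfc_id' ℝ T, cfc_const_zero] at h1
    rw [h1, zero_smul]
  · push Not at h0
    obtain ⟨l, hl, hl0⟩ := h0
    let g : ℝ → ℝ := fun x => if x = l then l⁻¹ else 0
    let h : ℝ → ℝ := fun x => if x = l then 1 else 0
    have hfin : (spectrum ℝ T).Finite := Matrix.finite_real_spectrum
    have hg : ContinuousOn g (spectrum ℝ T) := hfin.continuousOn g
    have hh : ContinuousOn h (spectrum ℝ T) := hfin.continuousOn h
    set p := cfc h T with hp
    have hpT : p = T * cfc g T := by
      conv_rhs => enter [1]; rw [← cfc_id' ℝ T]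
      rw [← cfc_mul (fun x => x) g T continuous_id.continuousOn hg]
      refine cfc_congr fun x _ => ?_
      simp only [g, h]
      split_ifs with hx
      · rw [hx, mul_inv_cancel₀ hl0]
      · rw [mul_zero]
    have hTp : T * p = (l : ℂ) • p := by
      have h1 : T * p = l • p := by
        conv_lhs => enter [1]; rw [← cfc_id' ℝ T]
        rw [hp, ← cfc_mul (fun x => x) h T continuous_id.continuousOn hh, ← cfc_const_mul l h T hh]
        refine cfc_congr fun x _ => ?_
        simp only [h]
        split_ifs with hx
        · rw [hx]
        · simp
      rw [h1]; rfl
    have hproj : IsStarProjection p := by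
      refine ⟨?_, cfc_predicate h T⟩
      rw [IsIdempotentElem, hp, ← cfc_mul _ _ T hh hh]
      refine cfc_congr fun x _ => ?_
      simp only [h]
      split_ifs <;> simp
    have hmem : p ∈ N := by
      have hc : IsClosed (N : Set (Matrix I I ℂ)) :=
        (N.toSubalgebra.toSubmodule).closed_of_finiteDimensional
      exact cfc_mem (hs := hc) h hT
    have hne : p ≠ 0 := by
      intro hp0
      have h1 : cfc h T = cfc (fun _ : ℝ => (0 : ℝ)) T := by rw [← hp, hp0, cfc_const_zero]
      have h2 := eqOn_of_cfc_eq_cfc h1 hh continuousOn_const hs hl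
      simp [h] at h2
    have hpe := he.eq_of_mul_eq p hmem hproj (by rw [hpT, ← Matrix.mul_assoc, heT]) hne
    refine ⟨l, ?_⟩
    have hTe : T * e = T := by
      have := congrArg Matrix.conjTranspose heT
      rwa [Matrix.conjTranspose_mul, he.conjTranspose_eq, ← Matrix.star_eq_conjTranspose,
        hs.star_eq] at this
    rw [← hTe, ← hpe, hTp]

/-- The corner of a minimal projection is one-dimensional. -/
theorem IsMinimalProjection.exists_smul (he : IsMinimalProjection N e)
    {T : Matrix I I ℂ} (hT : T ∈ N) (h1 : e * T = T) (h2 : T * e = T) :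
    ∃ c : ℂ, T = c • e := by
  have hTs : Tᴴ ∈ N := star_mem hT
  have h1' : e * Tᴴ = Tᴴ := by
    have := congrArg Matrix.conjTranspose h2
    rwa [Matrix.conjTranspose_mul, he.conjTranspose_eq] at this
  obtain ⟨a, ha⟩ := he.exists_smul_of_isSelfAdjoint (T := T + Tᴴ) (add_mem hT hTs)
    (by rw [IsSelfAdjoint, Matrix.star_eq_conjTranspose]; simp [add_comm])
    (by rw [mul_add, h1, h1'])
  obtain ⟨b, hb⟩ := he.exists_smul_of_isSelfAdjoint (T := Complex.I • (T - Tᴴ))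
    (SMulMemClass.smul_mem _ (sub_mem hT hTs))
    (by
      rw [IsSelfAdjoint, Matrix.star_eq_conjTranspose, Matrix.conjTranspose_smul]
      simp only [RCLike.star_def, Complex.conj_I, Matrix.conjTranspose_sub,
        Matrix.conjTranspose_conjTranspose]
      module)
    (by rw [mul_smul_comm, mul_sub, h1, h1'])
  refine ⟨(a - Complex.I * b) / 2, ?_⟩
  have h3 : T = (2 : ℂ)⁻¹ • ((T + Tᴴ) - Complex.I • (Complex.I • (T - Tᴴ))) := by
    rw [smul_smul, Complex.I_mul_I]
    module
  rw [ha, hb] at h3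
  rw [h3, smul_smul, ← sub_smul, smul_smul]
  congr 1
  ring

/-- A projection of the algebra is a sum of orthogonal minimal projections, by induction on its
range. -/
theorem exists_sum_isMinimalProjection (N : StarSubalgebra ℂ (Matrix I I ℂ)) (e : Matrix I I ℂ)
    (he : e ∈ N) (hp : IsStarProjection e) : ∃ s : Finset (Matrix I I ℂ),
      (∀ q ∈ s, IsMinimalProjection N q) ∧ (∀ q ∈ s, ∀ r ∈ s, q ≠ r → q * r = 0) ∧
        ∑ q ∈ s, q = e := by
  classical
  induction e using WellFounded.induction
    (InvImage.wf (fun e : Matrix I I ℂ => LinearMap.range e.mulVecLin) wellFounded_lt) with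
  | _ e ih
  have hstep : ∀ q ∈ N, IsStarProjection q → e * q = q → q ≠ e →
      LinearMap.range q.mulVecLin < LinearMap.range e.mulVecLin := by
    intro q _ hq heq hne
    rw [isStarProjection_iff_matrix] at hq hp
    refine lt_of_le_of_ne ?_ fun h => hne ?_
    · rintro _ ⟨v, rfl⟩
      exact ⟨q.mulVec v, by rw [Matrix.mulVecLin_apply, Matrix.mulVec_mulVec, heq]; rfl⟩
    · have h1 : q * e = e := by
        apply Matrix.ext_of_mulVec_single
        intro i
        obtain ⟨w, hw⟩ : e.mulVec (Pi.single i 1) ∈ LinearMap.range q.mulVecLin := h ▸ ⟨_, rfl⟩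
        rw [← Matrix.mulVec_mulVec, ← hw, Matrix.mulVecLin_apply, Matrix.mulVec_mulVec, hq.1]
      have h2 := congrArg Matrix.conjTranspose heq
      rw [Matrix.conjTranspose_mul, hq.2, hp.2] at h2
      rw [← h2, h1]
  by_cases h0 : e = 0
  · exact ⟨∅, by simp, by simp, by simp [h0]⟩
  by_cases hmin : IsMinimalProjection N e
  · refine ⟨{e}, by simpa using hmin, ?_, by simp⟩
    intro q hq r hr hqr
    rw [Finset.mem_singleton] at hq hr
    exact absurd (hq.trans hr.symm) hqr
  · obtain ⟨q, hqN, hq, heq, hq0, hqe⟩ : ∃ q ∈ N, IsStarProjection q ∧ e * q = q ∧ q ≠ 0 ∧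
        q ≠ e := by
      by_contra! hcon
      exact hmin ⟨he, hp, h0, hcon⟩
    have hqe' : q * e = q := by
      have h2 := congrArg Matrix.conjTranspose heq
      rwa [Matrix.conjTranspose_mul, (isStarProjection_iff_matrix.mp hq).2,
        (isStarProjection_iff_matrix.mp hp).2] at h2
    have hr : IsStarProjection (e - q) := by
      rw [isStarProjection_iff_matrix] at hq hp ⊢
      refine ⟨?_, by rw [Matrix.conjTranspose_sub, hq.2, hp.2]⟩
      rw [mul_sub, sub_mul, sub_mul, hp.1, hq.1, heq, hqe']
      abel
    have her : e * (e - q) = e - q := by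
      rw [mul_sub, heq, (isStarProjection_iff_matrix.mp hp).1]
    obtain ⟨s, hs1, hs2, hs3⟩ := ih q (hstep q hqN hq heq hqe) hqN hq
    obtain ⟨t, ht1, ht2, ht3⟩ := ih (e - q)
      (hstep _ (sub_mem he hqN) hr her (by simpa using hq0)) (sub_mem he hqN) hr
    -- members of `s` lie below `q`, those of `t` below `e - q`
    have habs : ∀ (s : Finset (Matrix I I ℂ)), (∀ q ∈ s, IsMinimalProjection N q) →
        (∀ q ∈ s, ∀ r ∈ s, q ≠ r → q * r = 0) → ∀ a ∈ s, a * ∑ b ∈ s, b = a := by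
      intro s h1 h2 a ha
      rw [Finset.mul_sum, Finset.sum_eq_single a (fun b hb hba => h2 a ha b hb hba.symm)
        (fun h => absurd ha h), (h1 a ha).mul_self]
    have hst : ∀ a ∈ s, ∀ b ∈ t, a * b = 0 := by
      intro a ha b hb
      have h1 := habs s hs1 hs2 a ha
      have h2 := congrArg Matrix.conjTranspose (habs t ht1 ht2 b hb)
      rw [ht3, Matrix.conjTranspose_mul, (ht1 b hb).conjTranspose_eq,
        (isStarProjection_iff_matrix.mp hr).2] at h2
      rw [hs3] at h1
      rw [← h1, ← h2, Matrix.mul_assoc, ← Matrix.mul_assoc q, mul_sub, hqe',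
        (isStarProjection_iff_matrix.mp hq).1, sub_self, Matrix.zero_mul, Matrix.mul_zero]
    have hts : ∀ b ∈ t, ∀ a ∈ s, b * a = 0 := by
      intro b hb a ha
      have := congrArg Matrix.conjTranspose (hst a ha b hb)
      rwa [Matrix.conjTranspose_mul, (hs1 a ha).conjTranspose_eq, (ht1 b hb).conjTranspose_eq,
        Matrix.conjTranspose_zero] at this
    have hdisj : Disjoint s t := by
      rw [Finset.disjoint_left]
      intro a ha hb
      exact (hs1 a ha).ne_zero ((hs1 a ha).mul_self ▸ hst a ha a hb)
    refine ⟨s ∪ t, ?_, ?_, ?_⟩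
    · intro a ha
      rcases Finset.mem_union.mp ha with ha | ha
      · exact hs1 a ha
      · exact ht1 a ha
    · intro a ha b hb hab
      rcases Finset.mem_union.mp ha with ha | ha <;> rcases Finset.mem_union.mp hb with hb | hb
      · exact hs2 a ha b hb hab
      · exact hst a ha b hb
      · exact hts a ha b hb
      · exact ht2 a ha b hb hab
    · rw [Finset.sum_union hdisj, hs3, ht3]
      abel

/-- A nonzero element of the algebra between two minimal projections is a multiple of a partial
isometry. -/
theorem IsMinimalProjection.exists_partialIsometry (he : IsMinimalProjection N e)
    (hf : IsMinimalProjection N f) {Z : Matrix I I ℂ} (hZ : Z ∈ N) (h0 : f * Z * e ≠ 0) :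
    ∃ u ∈ N, uᴴ * u = e ∧ u * uᴴ = f := by
  set T := f * Z * e with hT
  have hTN : T ∈ N := mul_mem (mul_mem hf.mem hZ) he.mem
  have hTs : Tᴴ ∈ N := star_mem hTN
  have hTe : T * e = T := by rw [hT, Matrix.mul_assoc, he.mul_self]
  have hfT : f * T = T := by rw [hT, ← Matrix.mul_assoc, ← Matrix.mul_assoc, hf.mul_self]
  have heT : e * Tᴴ = Tᴴ := by
    have := congrArg Matrix.conjTranspose hTe
    rwa [Matrix.conjTranspose_mul, he.conjTranspose_eq] at this
  have hTf : Tᴴ * f = Tᴴ := by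
    have := congrArg Matrix.conjTranspose hfT
    rwa [Matrix.conjTranspose_mul, hf.conjTranspose_eq] at this
  obtain ⟨c, hc⟩ := he.exists_smul (T := Tᴴ * T) (mul_mem hTs hTN)
    (by rw [← Matrix.mul_assoc, heT]) (by rw [Matrix.mul_assoc, hTe])
  obtain ⟨c', hc'⟩ := hf.exists_smul (T := T * Tᴴ) (mul_mem hTN hTs)
    (by rw [← Matrix.mul_assoc, hfT]) (by rw [Matrix.mul_assoc, hTf])
  have htr : ∀ A : Matrix I I ℂ, A ≠ 0 → 0 < (Aᴴ * A).trace := by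
    intro A hA
    refine lt_of_le_of_ne (Matrix.posSemidef_conjTranspose_mul_self A).trace_nonneg ?_
    exact fun h => hA (Matrix.trace_conjTranspose_mul_self_eq_zero_iff.mp h.symm)
  have hte : 0 < e.trace := by
    have := htr e he.ne_zero
    rwa [he.conjTranspose_eq, he.mul_self] at this
  have hcpos : 0 < c := by
    have h1 := htr T h0
    rw [hc, Matrix.trace_smul, smul_eq_mul] at h1
    exact pos_of_mul_pos_left h1 hte.le
  obtain ⟨hre, him⟩ := Complex.pos_iff.mp hcpos
  have hcr : c = ((c.re : ℝ) : ℂ) := Complex.ext (by simp) (by simp [← him])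
  let t : ℂ := ((Real.sqrt c.re : ℝ) : ℂ)⁻¹
  have htt : star t * t = c⁻¹ := by
    simp only [t, star_inv₀, RCLike.star_def, Complex.conj_ofReal]
    rw [← mul_inv, ← Complex.ofReal_mul, Real.mul_self_sqrt hre.le, ← hcr]
  have huu : (t • T)ᴴ * (t • T) = e := by
    rw [Matrix.conjTranspose_smul, smul_mul_smul_comm, htt, hc, smul_smul,
      inv_mul_cancel₀ hcpos.ne', one_smul]
  have huu' : (t • T) * (t • T)ᴴ = (c⁻¹ * c') • f := by
    rw [Matrix.conjTranspose_smul, smul_mul_smul_comm, mul_comm t, htt, hc', smul_smul]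
  refine ⟨t • T, SMulMemClass.smul_mem _ hTN, huu, ?_⟩
  -- `u * uᴴ` is a nonzero idempotent multiple of `f`
  have hidem : ((t • T) * (t • T)ᴴ) * ((t • T) * (t • T)ᴴ) = (t • T) * (t • T)ᴴ := by
    calc ((t • T) * (t • T)ᴴ) * ((t • T) * (t • T)ᴴ)
        = (t • T) * ((t • T)ᴴ * (t • T)) * (t • T)ᴴ := by simp only [Matrix.mul_assoc]
      _ = (t • T) * (t • T)ᴴ := by rw [huu, smul_mul_assoc t T e, hTe]
  have hne : (t • T) * (t • T)ᴴ ≠ 0 := by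
    intro h
    rw [Matrix.self_mul_conjTranspose_eq_zero] at h
    rw [h, Matrix.mul_zero] at huu
    exact he.ne_zero huu.symm
  rw [huu'] at hidem hne ⊢
  set a := c⁻¹ * c'
  have ha : a ≠ 0 := by rintro h; exact hne (by rw [h, zero_smul])
  rw [smul_mul_smul_comm, hf.mul_self] at hidem
  have h2 : (a * a - a) • f = 0 := by rw [sub_smul, hidem, sub_self]
  have h3 := (smul_eq_zero.mp h2).resolve_right hf.ne_zero
  have h4 : a = 1 := by
    have : a * (a - 1) = 0 := by linear_combination h3
    exact sub_eq_zero.mp ((mul_eq_zero.mp this).resolve_left ha)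
  rw [h4, one_smul]

/-- The classes of an equivalence relation on a finite type, numbered together with their
members. -/
theorem exists_sigma_fin_equiv {α : Type*} [Finite α] (r : Setoid α) :
    ∃ (M : ℕ) (d : Fin M → ℕ) (Θ : (Σ k, Fin (d k)) ≃ α), (∀ k, 0 < d k) ∧
      ∀ x y, r (Θ x) (Θ y) ↔ x.1 = y.1 := by
  classical
  have : Fintype α := Fintype.ofFinite α
  let e := Fintype.equivFin (Quotient r)
  let F : Quotient r → Type _ := fun k => {x : α // Quotient.mk r x = k}
  let d : Fin (Fintype.card (Quotient r)) → ℕ := fun k => Fintype.card (F (e.symm k))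
  let Θ : (Σ k, Fin (d k)) ≃ α :=
    (Equiv.sigmaCongr e.symm fun k => (Fintype.equivFin (F (e.symm k))).symm).trans
      (Equiv.sigmaFiberEquiv (Quotient.mk r))
  have hΘ : ∀ x, Quotient.mk r (Θ x) = e.symm x.1 := fun x =>
    ((Fintype.equivFin (F (e.symm x.1))).symm x.2).2
  refine ⟨_, d, Θ, fun k => ?_, fun x y => ?_⟩
  · obtain ⟨x, hx⟩ := Quotient.exists_rep (e.symm k)
    exact Fintype.card_pos_iff.mpr ⟨⟨x, hx⟩⟩
  · refine (Quotient.eq (r := r)).symm.trans ?_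
    rw [hΘ, hΘ, e.symm.injective.eq_iff]

/-- Matrix units of a star subalgebra: the products `u k a * (u k b)ᴴ` play the role of the
elementary matrices of the `k`-th block. -/
theorem exists_matrixUnits (N : StarSubalgebra ℂ (Matrix I I ℂ)) :
    ∃ (M : ℕ) (d : Fin M → ℕ) (r : Fin M → Matrix I I ℂ) (u : ∀ k, Fin (d k) → Matrix I I ℂ),
      (∀ k, 0 < d k) ∧ (∀ k, IsMinimalProjection N (r k)) ∧ (∀ k a, u k a ∈ N) ∧
      (∀ k a, (u k a)ᴴ * u k a = r k) ∧ ∑ k, ∑ a, u k a * (u k a)ᴴ = 1 ∧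
      (∀ k a b, a ≠ b → (u k a)ᴴ * u k b = 0) ∧
      (∀ Z ∈ N, ∀ k l a b, k ≠ l → (u k a)ᴴ * Z * u l b = 0) := by
  classical
  obtain ⟨s, hs1, hs2, hs3⟩ := exists_sum_isMinimalProjection N 1 (one_mem N) (.one _)
  let R : Setoid s :=
    { r := fun e f => ∃ u ∈ N, uᴴ * u = e.1 ∧ u * uᴴ = f.1
      iseqv :=
        { refl := fun e => ⟨e.1, (hs1 _ e.2).mem, by
            rw [(hs1 _ e.2).conjTranspose_eq, (hs1 _ e.2).mul_self], by
            rw [(hs1 _ e.2).conjTranspose_eq, (hs1 _ e.2).mul_self]⟩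
          symm := fun ⟨u, hu, h1, h2⟩ => ⟨uᴴ, star_mem hu, by
            rwa [Matrix.conjTranspose_conjTranspose], by rwa [Matrix.conjTranspose_conjTranspose]⟩
          trans := fun {e f g} ⟨u, hu, h1, h2⟩ ⟨v, hv, h3, h4⟩ => by
            have hf := (hs1 _ f.2).mul_self
            have he := (hs1 _ e.2).mul_self
            have hg := (hs1 _ g.2).mul_self
            refine ⟨v * u, mul_mem hv hu, ?_, ?_⟩
            · calc (v * u)ᴴ * (v * u) = uᴴ * (vᴴ * v) * u := by
                    simp only [Matrix.conjTranspose_mul, Matrix.mul_assoc]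
                _ = (uᴴ * u) * (uᴴ * u) := by
                    rw [h3, ← h2]; simp only [Matrix.mul_assoc]
                _ = e.1 := by rw [h1, he]
            · calc (v * u) * (v * u)ᴴ = v * (u * uᴴ) * vᴴ := by
                    simp only [Matrix.conjTranspose_mul, Matrix.mul_assoc]
                _ = (v * vᴴ) * (v * vᴴ) := by
                    rw [h2, ← h3]; simp only [Matrix.mul_assoc]
                _ = g.1 := by rw [h4, hg] } }
  obtain ⟨M, d, Θ, hd, hΘ⟩ := exists_sigma_fin_equiv R
  have hu : ∀ k a, ∃ u ∈ N, uᴴ * u = (Θ ⟨k, ⟨0, hd k⟩⟩).1 ∧ u * uᴴ = (Θ ⟨k, a⟩).1 :=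
    fun k a => (hΘ ⟨k, ⟨0, hd k⟩⟩ ⟨k, a⟩).mpr rfl
  choose u huN hu1 hu2 using hu
  have hmin : ∀ x, IsMinimalProjection N (Θ x).1 := fun x => hs1 _ (Θ x).2
  -- `u k a` has final projection `Θ ⟨k, a⟩`
  have hfu : ∀ k a, (Θ ⟨k, a⟩).1 * u k a = u k a := by
    intro k a
    have hx : (Θ ⟨k, a⟩).1 * u k a - u k a = 0 := by
      rw [← Matrix.self_mul_conjTranspose_eq_zero]
      have hp := (hmin ⟨k, a⟩).mul_self
      simp only [Matrix.conjTranspose_sub, Matrix.conjTranspose_mul,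
        (hmin ⟨k, a⟩).conjTranspose_eq, sub_mul, mul_sub]
      have e1 : (Θ ⟨k, a⟩).1 * u k a * (u k a)ᴴ = (Θ ⟨k, a⟩).1 := by
        rw [Matrix.mul_assoc, hu2, hp]
      simp only [← Matrix.mul_assoc, e1, hu2, hp, sub_self]
    exact sub_eq_zero.mp hx
  have huf : ∀ k a, (u k a)ᴴ * (Θ ⟨k, a⟩).1 = (u k a)ᴴ := by
    intro k a
    have := congrArg Matrix.conjTranspose (hfu k a)
    rwa [Matrix.conjTranspose_mul, (hmin ⟨k, a⟩).conjTranspose_eq] at this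
  refine ⟨M, d, fun k => (Θ ⟨k, ⟨0, hd k⟩⟩).1, u, hd, fun k => hmin _, huN, hu1, ?_, ?_, ?_⟩
  · simp only [hu2]
    rw [← Fintype.sum_sigma' (fun k a => (Θ ⟨k, a⟩).1), Equiv.sum_comp Θ (fun x => x.1), ← hs3]
    exact Finset.sum_coe_sort s fun x => x
  · intro k a b hab
    rw [← huf, ← hfu k b, Matrix.mul_assoc, ← Matrix.mul_assoc (Θ ⟨k, a⟩).1,
      hs2 _ (Θ ⟨k, a⟩).2 _ (Θ ⟨k, b⟩).2, Matrix.zero_mul, Matrix.mul_zero]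
    intro h
    have := Θ.injective (Subtype.ext h)
    simp only [Sigma.mk.injEq, heq_eq_eq, true_and] at this
    exact hab this
  · intro Z hZ k l a b hkl
    have h1 : (Θ ⟨k, a⟩).1 * Z * (Θ ⟨l, b⟩).1 = 0 := by
      by_contra hne
      obtain ⟨v, hv⟩ := (hmin ⟨l, b⟩).exists_partialIsometry (hmin ⟨k, a⟩) hZ hne
      exact hkl ((hΘ ⟨l, b⟩ ⟨k, a⟩).mp ⟨v, hv⟩).symm
    rw [← huf, ← hfu l b]
    calc (u k a)ᴴ * (Θ ⟨k, a⟩).1 * Z * ((Θ ⟨l, b⟩).1 * u l b)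
        = (u k a)ᴴ * ((Θ ⟨k, a⟩).1 * Z * (Θ ⟨l, b⟩).1) * u l b := by
          simp only [Matrix.mul_assoc]
      _ = 0 := by rw [h1, Matrix.mul_zero, Matrix.zero_mul]

/-- An orthogonal projection factors through an isometry from its range. -/
theorem exists_isometry_of_isStarProjection {q : Matrix I I ℂ} (hq : IsStarProjection q) :
    ∃ (m : ℕ) (E : Matrix I (Fin m) ℂ), Eᴴ * E = 1 ∧ E * Eᴴ = q := by
  let S : Submodule ℂ (EuclideanSpace ℂ I) :=
    LinearMap.range ((Matrix.toEuclideanCLM (𝕜 := ℂ) (n := I) q :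
      EuclideanSpace ℂ I →L[ℂ] EuclideanSpace ℂ I) : EuclideanSpace ℂ I →ₗ[ℂ] EuclideanSpace ℂ I)
  let b := stdOrthonormalBasis ℂ S
  let E : Matrix I (Fin (finrank ℂ S)) ℂ := Matrix.of fun i j => (b j : EuclideanSpace ℂ I) i
  have h1 : Eᴴ * E = 1 := by
    ext i j
    have h := orthonormal_iff_ite.mp b.orthonormal i j
    rw [Submodule.coe_inner, EuclideanSpace.inner_eq_star_dotProduct, dotProduct_comm] at h
    rw [Matrix.one_apply, ← h]
    rfl
  have h2 : q * E = E := by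
    ext i j
    obtain ⟨w, hw⟩ := (b j).2
    have h3 : Matrix.toEuclideanCLM (𝕜 := ℂ) q (b j : EuclideanSpace ℂ I) = b j := by
      rw [← hw]
      change (Matrix.toEuclideanCLM (𝕜 := ℂ) q * Matrix.toEuclideanCLM (𝕜 := ℂ) q) w = _
      rw [← map_mul, hq.isIdempotentElem.eq]
      rfl
    exact congrFun (congrArg WithLp.ofLp h3) i
  have h4 : E * Eᴴ * q = q := by
    refine matrix_ext_of_toEuclideanCLM fun x => ?_
    rw [map_mul, mul_apply_eq_comp]
    set y := Matrix.toEuclideanCLM (𝕜 := ℂ) q x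
    have hy : y ∈ S := ⟨x, rfl⟩
    have h5 := congrArg Subtype.val (b.sum_repr' ⟨y, hy⟩)
    ext i
    have h6 := congrFun (congrArg WithLp.ofLp h5) i
    rw [← h6, Matrix.ofLp_toEuclideanCLM, ← Matrix.mulVec_mulVec]
    simp only [Submodule.coe_sum, Submodule.coe_smul, Submodule.coe_inner, WithLp.ofLp_sum,
      Finset.sum_apply, WithLp.ofLp_smul, Pi.smul_apply, smul_eq_mul, Matrix.mulVec, dotProduct]
    refine Finset.sum_congr rfl fun j _ => ?_
    rw [EuclideanSpace.inner_eq_star_dotProduct, dotProduct_comm, mul_comm]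
    rfl
  refine ⟨_, E, h1, ?_⟩
  have h5 := congrArg Matrix.conjTranspose h4
  have hqs : qᴴ = q := hq.isSelfAdjoint
  rw [Matrix.conjTranspose_mul, Matrix.conjTranspose_mul, Matrix.conjTranspose_conjTranspose,
    hqs, ← Matrix.mul_assoc, h2] at h5
  exact h5

/-- The structure of star subalgebras of a full matrix algebra: in suitable orthonormal
coordinates, such an algebra consists of the block diagonal matrices with blocks `x k ⊗ 1`. -/
theorem exists_blockDiagonal_coordinates (N : StarSubalgebra ℂ (Matrix I I ℂ)) :
    ∃ (M : ℕ) (d m : Fin M → ℕ) (W : Matrix I (Σ k, Fin (d k) × Fin (m k)) ℂ),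
      (∀ k, 0 < d k) ∧ (∀ k, 0 < m k) ∧ Wᴴ * W = 1 ∧ W * Wᴴ = 1 ∧
      ∀ Z, Z ∈ N ↔ ∃ x : ∀ k, Matrix (Fin (d k)) (Fin (d k)) ℂ,
        Z = W * (Matrix.blockDiagonal' fun k => x k ⊗ₖ (1 : Matrix (Fin (m k)) (Fin (m k)) ℂ)) *
          Wᴴ := by
  classical
  obtain ⟨M, d, r, u, hd, hr, huN, hu1, hu2, hu3, hu4⟩ := exists_matrixUnits N
  choose m E hE1 hE2 using fun k => exists_isometry_of_isStarProjection (hr k).isStarProjection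
  have hur : ∀ k a, u k a * r k = u k a := by
    intro k a
    have hx : u k a * r k - u k a = 0 := by
      rw [← Matrix.conjTranspose_mul_self_eq_zero]
      simp only [Matrix.conjTranspose_sub, Matrix.conjTranspose_mul, (hr k).conjTranspose_eq,
        sub_mul, mul_sub, Matrix.mul_assoc]
      simp only [← Matrix.mul_assoc ((u k a)ᴴ), hu1, (hr k).mul_self,
        sub_self]
    exact sub_eq_zero.mp hx
  let W : Matrix I (Σ k, Fin (d k) × Fin (m k)) ℂ :=
    Matrix.of fun i x => (u x.1 x.2.1 * E x.1) i x.2.2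
  have hblock : ∀ (Y : Matrix I I ℂ) (x : ∀ k, Matrix (Fin (d k)) (Fin (d k)) ℂ),
      (∀ k l a b, k ≠ l → (u k a)ᴴ * Y * u l b = 0) →
      (∀ k a b, (u k a)ᴴ * Y * u k b = x k a b • r k) →
      Wᴴ * Y * W =
        Matrix.blockDiagonal' fun k => x k ⊗ₖ (1 : Matrix (Fin (m k)) (Fin (m k)) ℂ) := by
    intro Y x h1 h2
    ext ⟨k, a, p⟩ ⟨l, b, q⟩
    have h3 : (Wᴴ * Y * W) ⟨k, a, p⟩ ⟨l, b, q⟩ =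
        ((E k)ᴴ * ((u k a)ᴴ * Y * u l b) * E l) p q := by
      have h4 : (E k)ᴴ * ((u k a)ᴴ * Y * u l b) * E l =
          (u k a * E k)ᴴ * Y * (u l b * E l) := by
        simp only [Matrix.conjTranspose_mul, Matrix.mul_assoc]
      rw [h4]
      rfl
    rw [h3]
    by_cases hkl : k = l
    · subst hkl
      rw [h2, Matrix.blockDiagonal'_apply_eq, Matrix.kroneckerMap_apply, ← hE2]
      generalize x k a b = c
      rw [Matrix.mul_smul, Matrix.smul_mul, ← Matrix.mul_assoc, hE1, Matrix.one_mul, hE1]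
      rfl
    · rw [h1 k l a b hkl, Matrix.blockDiagonal'_apply_ne _ _ _ hkl]
      simp
  have hWW : Wᴴ * W = 1 := by
    have h := hblock 1 (fun _ => 1) (fun k l a b hkl => hu4 1 (one_mem N) k l a b hkl) (by
      intro k a b
      rw [Matrix.mul_one, Matrix.one_apply]
      split_ifs with hab
      · rw [hab, hu1, one_smul]
      · rw [hu3 k a b hab, zero_smul])
    rw [Matrix.mul_one] at h
    rw [h]
    simp only [Matrix.one_kronecker_one]
    exact Matrix.blockDiagonal'_one
  have hWW' : W * Wᴴ = 1 := by
    rw [← hu2]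
    ext i j
    rw [Matrix.mul_apply, Fintype.sum_sigma, Matrix.sum_apply]
    refine Finset.sum_congr rfl fun k _ => ?_
    rw [Fintype.sum_prod_type, Matrix.sum_apply]
    refine Finset.sum_congr rfl fun a _ => ?_
    have h1 : u k a * (u k a)ᴴ = (u k a * E k) * (u k a * E k)ᴴ := by
      rw [Matrix.conjTranspose_mul, Matrix.mul_assoc, ← Matrix.mul_assoc (E k), hE2,
        ← Matrix.mul_assoc, hur]
    rw [h1, Matrix.mul_apply]
    rfl
  refine ⟨M, d, m, W, hd, fun k => ?_, hWW, hWW', fun Z => ⟨fun hZ => ?_, ?_⟩⟩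
  · rw [Nat.pos_iff_ne_zero]
    intro h0
    have : IsEmpty (Fin (m k)) := by rw [h0]; infer_instance
    apply (hr k).ne_zero
    rw [← hE2]
    ext i j
    simp [Matrix.mul_apply]
  · have hc : ∀ k a b, ∃ c : ℂ, (u k a)ᴴ * Z * u k b = c • r k := by
      intro k a b
      have h1 : r k * (u k a)ᴴ = (u k a)ᴴ := by
        have := congrArg Matrix.conjTranspose (hur k a)
        rwa [Matrix.conjTranspose_mul, (hr k).conjTranspose_eq] at this
      exact (hr k).exists_smul (mul_mem (mul_mem (star_mem (huN k a)) hZ) (huN k b))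
        (by rw [← Matrix.mul_assoc, ← Matrix.mul_assoc, h1]) (by rw [Matrix.mul_assoc, hur])
    choose x hx using hc
    refine ⟨fun k => Matrix.of (x k), ?_⟩
    rw [← hblock Z (fun k => Matrix.of (x k)) (fun k l a b hkl => hu4 Z hZ k l a b hkl) hx]
    simp only [Matrix.mul_assoc, hWW', Matrix.mul_one]
    rw [← Matrix.mul_assoc, hWW', Matrix.one_mul]
  · rintro ⟨x, rfl⟩
    let Y : Matrix I I ℂ := ∑ k, ∑ a, ∑ b, x k a b • (u k a * (u k b)ᴴ)
    have hYN : Y ∈ N := sum_mem fun k _ => sum_mem fun a _ => sum_mem fun b _ =>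
      SMulMemClass.smul_mem _ (mul_mem (huN k a) (star_mem (huN k b)))
    have hY : ∀ k a b, (u k a)ᴴ * Y * u k b = x k a b • r k := by
      intro k a b
      simp only [Y, Finset.mul_sum, Finset.sum_mul]
      rw [Finset.sum_eq_single k, Finset.sum_eq_single a, Finset.sum_eq_single b]
      · generalize x k a b = c
        rw [mul_smul_comm, smul_mul_assoc, ← Matrix.mul_assoc, hu1, Matrix.mul_assoc, hu1,
          (hr k).mul_self]
      · intro b' _ hb
        rw [mul_smul_comm, smul_mul_assoc, Matrix.mul_assoc, Matrix.mul_assoc,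
          hu3 k b' b hb, Matrix.mul_zero, Matrix.mul_zero, smul_zero]
      · simp
      · intro a' _ ha
        refine Finset.sum_eq_zero fun b' _ => ?_
        rw [mul_smul_comm, smul_mul_assoc, ← Matrix.mul_assoc, hu3 k a a' ha.symm,
          Matrix.zero_mul, Matrix.zero_mul, smul_zero]
      · simp
      · intro k' _ hk
        refine Finset.sum_eq_zero fun a' _ => Finset.sum_eq_zero fun b' _ => ?_
        have h1 := hu4 1 (one_mem N) k k' a a' hk.symm
        rw [Matrix.mul_one] at h1
        rw [mul_smul_comm, smul_mul_assoc, ← Matrix.mul_assoc, h1,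
          Matrix.zero_mul, Matrix.zero_mul, smul_zero]
      · simp
    rw [← hblock Y x (fun k l a b hkl => hu4 Y hYN k l a b hkl) hY]
    have : W * (Wᴴ * Y * W) * Wᴴ = Y := by
      simp only [Matrix.mul_assoc, hWW', Matrix.mul_one]
      rw [← Matrix.mul_assoc, hWW', Matrix.one_mul]
    rw [this]
    exact hYN

end StarSubalgebra

/-! ### The block form of the attractor subspace -/

section Blocks

variable {M : ℕ} {d m : Fin M → ℕ}

/-- The block diagonal matrix with blocks `x k ⊗ 1`. -/
def ampl (m : Fin M → ℕ) (x : ∀ k, Matrix (Fin (d k)) (Fin (d k)) ℂ) :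
    Matrix (Σ k, Fin (d k) × Fin (m k)) (Σ k, Fin (d k) × Fin (m k)) ℂ :=
  Matrix.blockDiagonal' fun k => x k ⊗ₖ (1 : Matrix (Fin (m k)) (Fin (m k)) ℂ)

/-- The block diagonal matrix with blocks `x k ⊗ ρ k`. -/
def blockMatrix (x : ∀ k, Matrix (Fin (d k)) (Fin (d k)) ℂ)
    (ρ : ∀ k, Matrix (Fin (m k)) (Fin (m k)) ℂ) :
    Matrix (Σ k, Fin (d k) × Fin (m k)) (Σ k, Fin (d k) × Fin (m k)) ℂ :=
  Matrix.blockDiagonal' fun k => x k ⊗ₖ ρ k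

theorem ampl_mul_blockMatrix (x y : ∀ k, Matrix (Fin (d k)) (Fin (d k)) ℂ)
    (ρ : ∀ k, Matrix (Fin (m k)) (Fin (m k)) ℂ) :
    ampl m x * blockMatrix y ρ = blockMatrix (x * y) ρ := by
  rw [ampl, blockMatrix, blockMatrix, ← Matrix.blockDiagonal'_mul]
  simp only [← Matrix.mul_kronecker_mul, Matrix.one_mul, Pi.mul_apply]

theorem blockMatrix_mul_ampl (x y : ∀ k, Matrix (Fin (d k)) (Fin (d k)) ℂ)
    (ρ : ∀ k, Matrix (Fin (m k)) (Fin (m k)) ℂ) :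
    blockMatrix x ρ * ampl m y = blockMatrix (x * y) ρ := by
  rw [ampl, blockMatrix, blockMatrix, ← Matrix.blockDiagonal'_mul]
  simp only [← Matrix.mul_kronecker_mul, Matrix.mul_one, Pi.mul_apply]

theorem blockMatrix_one_one :
    blockMatrix (1 : ∀ k, Matrix (Fin (d k)) (Fin (d k)) ℂ)
      (1 : ∀ k, Matrix (Fin (m k)) (Fin (m k)) ℂ) = 1 := by
  simp only [blockMatrix, Pi.one_apply, Matrix.one_kronecker_one]
  exact Matrix.blockDiagonal'_one

theorem isUnit_blockMatrix {y : ∀ k, Matrix (Fin (d k)) (Fin (d k)) ℂ}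
    {ρ : ∀ k, Matrix (Fin (m k)) (Fin (m k)) ℂ} (hy : ∀ k, IsUnit (y k)) (hρ : ∀ k, IsUnit (ρ k)) :
    IsUnit (blockMatrix y ρ) := by
  refine IsUnit.of_mul_eq_one (blockMatrix (fun k => (y k)⁻¹) fun k => (ρ k)⁻¹) ?_
  rw [← blockMatrix_one_one, blockMatrix, blockMatrix, blockMatrix, ← Matrix.blockDiagonal'_mul]
  congr 1
  ext1 k
  rw [← Matrix.mul_kronecker_mul,
    Matrix.mul_nonsing_inv _ ((Matrix.isUnit_iff_isUnit_det _).mp (hy k)),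
    Matrix.mul_nonsing_inv _ ((Matrix.isUnit_iff_isUnit_det _).mp (hρ k))]
  rfl

theorem ampl_mul_apply (x : ∀ k, Matrix (Fin (d k)) (Fin (d k)) ℂ) {κ : Type*}
    (X : Matrix (Σ k, Fin (d k) × Fin (m k)) κ ℂ) (k : Fin M) (a : Fin (d k)) (p : Fin (m k))
    (j : κ) : (ampl m x * X) ⟨k, a, p⟩ j = ∑ b, x k a b * X ⟨k, b, p⟩ j := by
  rw [Matrix.mul_apply, Fintype.sum_sigma, Finset.sum_eq_single k, Fintype.sum_prod_type]
  · refine Finset.sum_congr rfl fun b _ => ?_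
    rw [Finset.sum_eq_single p]
    · rw [ampl, Matrix.blockDiagonal'_apply_eq, Matrix.kroneckerMap_apply, Matrix.one_apply_eq,
        mul_one]
    · intro q _ hq
      rw [ampl, Matrix.blockDiagonal'_apply_eq, Matrix.kroneckerMap_apply,
        Matrix.one_apply_ne hq.symm, mul_zero, zero_mul]
    · simp
  · intro l _ hl
    refine Finset.sum_eq_zero fun y _ => ?_
    rw [ampl, Matrix.blockDiagonal'_apply_ne _ _ _ hl.symm, zero_mul]
  · simp

theorem ampl_conjTranspose (x : ∀ k, Matrix (Fin (d k)) (Fin (d k)) ℂ) :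
    (ampl m x)ᴴ = ampl m (star x) := by
  rw [ampl, Matrix.blockDiagonal'_conjTranspose]
  simp only [Matrix.conjTranspose_kronecker, Matrix.conjTranspose_one]
  rfl

theorem mul_ampl_apply (x : ∀ k, Matrix (Fin (d k)) (Fin (d k)) ℂ) {κ : Type*}
    (X : Matrix κ (Σ k, Fin (d k) × Fin (m k)) ℂ) (k : Fin M) (a : Fin (d k)) (p : Fin (m k))
    (j : κ) : (X * ampl m x) j ⟨k, a, p⟩ = ∑ b, X j ⟨k, b, p⟩ * x k b a := by
  have h : X * ampl m x = (ampl m (star x) * Xᴴ)ᴴ := by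
    rw [Matrix.conjTranspose_mul, Matrix.conjTranspose_conjTranspose, ampl_conjTranspose, star_star]
  rw [h, Matrix.conjTranspose_apply, ampl_mul_apply, star_sum]
  refine Finset.sum_congr rfl fun b _ => ?_
  rw [star_mul, Matrix.conjTranspose_apply, star_star, Pi.star_apply, Matrix.star_apply, star_star]

theorem piSingle_apply_ne {k l : Fin M} (h : l ≠ k) (A : Matrix (Fin (d k)) (Fin (d k)) ℂ)
    (a b : Fin (d l)) :
    (Pi.single k A : ∀ k, Matrix (Fin (d k)) (Fin (d k)) ℂ) l a b = 0 := by
  rw [Pi.single_eq_of_ne h]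
  rfl

/-- Compressing `X` to the first copy of each multiplicity space and spreading the result over all
copies is a combination of two-sided multiplications by elements `x ⊗ 1`. -/
theorem sum_ampl_mul_mul_ampl (z : ∀ k, Fin (d k)) (c : Fin M → ℂ)
    (X : Matrix (Σ k, Fin (d k) × Fin (m k)) (Σ k, Fin (d k) × Fin (m k)) ℂ) :
    ∑ k, ∑ a, c k • (ampl m (Pi.single k (Matrix.single a (z k) 1)) * X *
      ampl m (Pi.single k (Matrix.single (z k) a 1))) =
    blockMatrix 1 fun k => c k • X.submatrix (fun p => ⟨k, z k, p⟩) (fun p => ⟨k, z k, p⟩) := by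
  ext ⟨k, a, p⟩ ⟨l, b, q⟩
  simp only [Matrix.sum_apply, Matrix.smul_apply, mul_ampl_apply, ampl_mul_apply]
  rw [Finset.sum_eq_single k]
  · rw [Finset.sum_eq_single a]
    · simp only [Pi.single_eq_same]
      by_cases hkl : k = l
      · subst hkl
        rw [blockMatrix, Matrix.blockDiagonal'_apply_eq, Matrix.kroneckerMap_apply,
          Finset.sum_eq_single (z k), Finset.sum_eq_single (z k)]
        · simp only [Pi.single_eq_same, Matrix.single_apply_same, Pi.one_apply, one_mul,
            Matrix.smul_apply, Matrix.submatrix_apply, smul_eq_mul]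
          by_cases hab : a = b
          · subst hab
            simp
          · rw [Matrix.one_apply_ne hab, Matrix.single_apply_of_col_ne _ _ hab]
            simp
        · intro b' _ hb
          rw [Matrix.single_apply_of_col_ne _ _ hb.symm, zero_mul]
        · simp
        · intro b' _ hb
          rw [Pi.single_eq_same, Matrix.single_apply_of_row_ne hb.symm, mul_zero]
        · simp
      · rw [blockMatrix, Matrix.blockDiagonal'_apply_ne _ _ _ hkl]
        simp [piSingle_apply_ne (Ne.symm hkl)]
    · intro a' _ ha
      simp only [Pi.single_eq_same]
      simp [Matrix.single_apply_of_row_ne ha]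
    · simp
  · intro k' _ hk
    simp [piSingle_apply_ne hk.symm]
  · simp

end Blocks

section Isometry

variable {I K : Type*} [Fintype I] [DecidableEq I] [Fintype K] [DecidableEq K]

/-- The isometry of Euclidean spaces given by a matrix with orthonormal columns. -/
noncomputable def matrixIsometry (W : Matrix I K ℂ) (hW : Wᴴ * W = 1) :
    EuclideanSpace ℂ K →ₗᵢ[ℂ] EuclideanSpace ℂ I :=
  (Matrix.toEuclideanLin W).isometryOfInner fun x y => by
    rw [← LinearMap.adjoint_inner_right, ← Matrix.toEuclideanLin_conjTranspose_eq_adjoint]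
    congr 1
    ext i
    change (Wᴴ *ᵥ (W *ᵥ y.ofLp)) i = y i
    rw [Matrix.mulVec_mulVec, hW, Matrix.one_mulVec]

theorem matrixIsometry_apply (W : Matrix I K ℂ) (hW : Wᴴ * W = 1) (x : EuclideanSpace ℂ K) :
    matrixIsometry W hW x = WithLp.toLp 2 (W *ᵥ x.ofLp) := rfl

variable {H : Type*} [NormedAddCommGroup H] [InnerProductSpace ℂ H] [CompleteSpace H]
  [FiniteDimensional ℂ H]

theorem liftOp_comp_matrixIsometry (J : EuclideanSpace ℂ I →ₗᵢ[ℂ] H) (W : Matrix I K ℂ)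
    (hW : Wᴴ * W = 1) (Y : Matrix K K ℂ) :
    liftOp (J.comp (matrixIsometry W hW)) Y = liftOp J (W * Y * Wᴴ) := by
  ext1 v
  rw [liftOp_apply, liftOp_apply]
  have h1 : ContinuousLinearMap.adjoint (J.comp (matrixIsometry W hW)).toContinuousLinearMap v =
      WithLp.toLp 2 (Wᴴ *ᵥ (ContinuousLinearMap.adjoint J.toContinuousLinearMap v).ofLp) := by
    refine ext_inner_right ℂ fun x => ?_
    rw [ContinuousLinearMap.adjoint_inner_left]
    have h2 : inner ℂ (WithLp.toLp 2
        (Wᴴ *ᵥ (ContinuousLinearMap.adjoint J.toContinuousLinearMap v).ofLp)) x =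
        inner ℂ (ContinuousLinearMap.adjoint J.toContinuousLinearMap v)
          (matrixIsometry W hW x) := by
      have h3 := LinearMap.adjoint_inner_left (Matrix.toEuclideanLin W) x
        (ContinuousLinearMap.adjoint J.toContinuousLinearMap v)
      rw [← Matrix.toEuclideanLin_conjTranspose_eq_adjoint] at h3
      exact h3
    rw [h2, ContinuousLinearMap.adjoint_inner_left]
    rfl
  rw [h1]
  change J (matrixIsometry W hW _) = J _
  rw [matrixIsometry_apply]
  congr 1
  ext i
  simp only [Matrix.ofLp_toEuclideanCLM, ← Matrix.mulVec_mulVec]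

end Isometry

section AttractorForm

variable {H : Type*} [NormedAddCommGroup H] [InnerProductSpace ℂ H] [CompleteSpace H]
  [FiniteDimensional ℂ H]

theorem blockOperator_eq_liftOp {M : ℕ} {d m : Fin M → ℕ}
    (V : EuclideanSpace ℂ (Σ k, Fin (d k) × Fin (m k)) →ₗᵢ[ℂ] H)
    (x : ∀ k, Matrix (Fin (d k)) (Fin (d k)) ℂ) (ρ : ∀ k, Matrix (Fin (m k)) (Fin (m k)) ℂ) :
    blockOperator V x ρ = liftOp V (blockMatrix x ρ) := rfl

theorem conjTranspose_mem_peripheralSpan_krausMap {I : Type*} [Fintype I] [DecidableEq I]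
    {ι : Type*} [Fintype ι] (L : ι → Matrix I I ℂ) {X : Matrix I I ℂ}
    (hX : X ∈ peripheralSpan (krausMap L)) : Xᴴ ∈ peripheralSpan (krausMap L) := by
  refine peripheralSpan_induction (p := fun X => Xᴴ ∈ peripheralSpan (krausMap L))
    (fun μ X hμ hX => ?_) (fun X Y hX hY => ?_) hX
  · refine mem_peripheralSpan (μ := star μ) (by simpa using hμ) ?_
    rw [krausMap_conjTranspose, hX, Matrix.conjTranspose_smul]
  · rw [Matrix.conjTranspose_add]; exact Submodule.add_mem _ hX hY

/-- The space spanned by the peripheral eigenvectors is a bimodule over the star algebra `N`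
obtained from it by division by `ω`. -/
theorem mul_mul_mem_peripheralSpan_krausMap {I : Type*} [Fintype I] [DecidableEq I]
    {ι : Type*} [Fintype ι] {L : ι → Matrix I I ℂ} (hL : ∑ i, (L i)ᴴ * L i = 1)
    {ω : Matrix I I ℂ} (hω : ω.PosDef) (hfix : krausMap L ω = ω) {Z Z' : Matrix I I ℂ}
    (hZ : Z ∈ peripheralAlgebra hL hω hfix) (hZ' : Z' ∈ peripheralAlgebra hL hω hfix) :
    Z * ω * Z' ∈ peripheralSpan (krausMap L) := by
  have h1 : Z'ᴴ * ω ∈ peripheralSpan (krausMap L) := by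
    rw [peripheralSpan_krausMap hω]
    exact ⟨_, star_mem (s := peripheralAlgebra hL hω hfix) hZ', rfl⟩
  have h2 := conjTranspose_mem_peripheralSpan_krausMap L h1
  rw [Matrix.conjTranspose_mul, Matrix.conjTranspose_conjTranspose,
    show ωᴴ = ω from hω.isHermitian] at h2
  rw [peripheralSpan_krausMap hω] at h2 ⊢
  obtain ⟨Y, hY, hY'⟩ := h2
  refine ⟨Z * Y, mul_mem (S := StarSubalgebra ℂ (Matrix I I ℂ)) (s := peripheralAlgebra hL hω hfix)
    hZ hY, ?_⟩
  rw [LinearMap.mulRight_apply] at hY' ⊢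
  rw [Matrix.mul_assoc, hY', Matrix.mul_assoc]

/-- The structure of the attractor subspace of a channel. The operators `ρ k` are the normalized
compressions of the invertible fixed point to one copy of the `k`-th multiplicity space. -/
theorem HasKrausForm.exists_attractor_form {Φ : End ℂ (H →L[ℂ] H)} (hΦ : HasKrausForm Φ) :
    ∃ (M : ℕ) (d m : Fin M → ℕ) (V : EuclideanSpace ℂ (Σ k, Fin (d k) × Fin (m k)) →ₗᵢ[ℂ] H)
      (ρ : ∀ k, Matrix (Fin (m k)) (Fin (m k)) ℂ), (∀ k, 0 < d k) ∧
      LinearMap.range V.toLinearMap =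
        LinearMap.range (eigenprojection Φ 1 (1 : H →L[ℂ] H) : H →ₗ[ℂ] H) ∧
      (∀ k, (ρ k).PosDef) ∧ (∀ k, (ρ k).trace = 1) ∧
      (attractor Φ : Set (H →L[ℂ] H)) = Set.range fun x => blockOperator V x ρ := by
  let S := LinearMap.range (eigenprojection Φ 1 (1 : H →L[ℂ] H) : H →ₗ[ℂ] H)
  let J : EuclideanSpace ℂ (Fin (finrank ℂ S)) →ₗᵢ[ℂ] H :=
    S.subtypeₗᵢ.comp (stdOrthonormalBasis ℂ S).repr.symm.toLinearIsometry
  have hJ : LinearMap.range J.toLinearMap = S := by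
    ext v
    constructor
    · rintro ⟨x, rfl⟩
      exact ((stdOrthonormalBasis ℂ S).repr.symm x).2
    · intro hv
      exact ⟨(stdOrthonormalBasis ℂ S).repr ⟨v, hv⟩, by simp [J]⟩
  obtain ⟨ι, _, L, ω, hL, hω, hfix, hlift, hQ, hattr⟩ := hΦ.exists_compression hJ
  let N := peripheralAlgebra hL hω hfix
  obtain ⟨M, d, m, W, hd, hm, hW, hW', hN⟩ := exists_blockDiagonal_coordinates N
  have hN' : ∀ x : (∀ k, Matrix (Fin (d k)) (Fin (d k)) ℂ), W * ampl m x * Wᴴ ∈ N :=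
    fun x => (hN _).mpr ⟨x, rfl⟩
  have hωW : (Wᴴ * ω * W).PosDef := by
    refine hω.conjTranspose_mul_mul_same fun x y hxy => ?_
    have := congrArg (Wᴴ.mulVec) hxy
    simpa [Matrix.mulVec_mulVec, hW] using this
  let ρ₀ : ∀ k, Matrix (Fin (m k)) (Fin (m k)) ℂ := fun k =>
    (Wᴴ * ω * W).submatrix (fun p => ⟨k, ⟨0, hd k⟩, p⟩) (fun p => ⟨k, ⟨0, hd k⟩, p⟩)
  have hρ₀ : ∀ k, (ρ₀ k).PosDef := fun k => hωW.submatrix fun p q hpq => by simpa using hpq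
  have htr : ∀ k, 0 < (ρ₀ k).trace := fun k => by
    have : Nonempty (Fin (m k)) := ⟨⟨0, hm k⟩⟩
    exact (hρ₀ k).trace_pos
  let ρ : ∀ k, Matrix (Fin (m k)) (Fin (m k)) ℂ := fun k => ((ρ₀ k).trace)⁻¹ • ρ₀ k
  have hρ : ∀ k, (ρ k).PosDef := fun k => (hρ₀ k).smul (inv_pos.mpr (htr k))
  set R : Matrix (Fin (finrank ℂ S)) (Fin (finrank ℂ S)) ℂ :=
    W * (blockMatrix 1 ρ : Matrix (Σ k, Fin (d k) × Fin (m k)) (Σ k, Fin (d k) × Fin (m k)) ℂ) * Wᴴ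
    with hR
  have hRmem : R ∈ peripheralSpan (krausMap L) := by
    rw [hR, ← sum_ampl_mul_mul_ampl (fun k => ⟨0, hd k⟩) (fun k => ((ρ₀ k).trace)⁻¹)
      (Wᴴ * ω * W), Matrix.mul_sum, Matrix.sum_mul]
    refine Submodule.sum_mem _ fun k _ => ?_
    rw [Matrix.mul_sum, Matrix.sum_mul]
    refine Submodule.sum_mem _ fun a _ => ?_
    rw [Matrix.mul_smul, Matrix.smul_mul]
    refine Submodule.smul_mem _ _ ?_
    have := mul_mul_mem_peripheralSpan_krausMap hL hω hfix
      (hN' (Pi.single k (Matrix.single a ⟨0, hd k⟩ 1)))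
      (hN' (Pi.single k (Matrix.single ⟨0, hd k⟩ a 1)))
    convert this using 1
    simp only [Matrix.mul_assoc]
  have hRunit : IsUnit R := by
    obtain ⟨B, hB, -⟩ := isUnit_iff_exists.mp
      (isUnit_blockMatrix (y := (1 : ∀ k, Matrix (Fin (d k)) (Fin (d k)) ℂ))
        (fun k => isUnit_one) fun k => (hρ k).isUnit)
    refine IsUnit.of_mul_eq_one (W * B * Wᴴ) ?_
    calc R * (W * B * Wᴴ) = W * (blockMatrix 1 ρ * (Wᴴ * W) * B) * Wᴴ := by
          rw [hR]; simp only [Matrix.mul_assoc]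
      _ = 1 := by rw [hW, Matrix.mul_one, hB, Matrix.mul_one, hW']
  -- right multiples of `N` by `ω` and by `R` agree, by comparison of dimensions
  have hspan : peripheralSpan (krausMap L) =
      N.toSubalgebra.toSubmodule.map (LinearMap.mulRight ℂ R) := by
    have hle : N.toSubalgebra.toSubmodule.map (LinearMap.mulRight ℂ R) ≤
        peripheralSpan (krausMap L) := by
      rintro _ ⟨Z, hZ, rfl⟩
      rw [peripheralSpan_krausMap hω] at hRmem ⊢
      obtain ⟨Y, hY, hY'⟩ := hRmem
      refine ⟨Z * Y, mul_mem (S := StarSubalgebra ℂ _) (s := N) hZ hY, ?_⟩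
      rw [LinearMap.mulRight_apply] at hY' ⊢
      rw [Matrix.mul_assoc, hY', LinearMap.mulRight_apply]
    refine (Submodule.eq_of_le_of_finrank_eq hle ?_).symm
    have h1 : finrank ℂ (N.toSubalgebra.toSubmodule.map (LinearMap.mulRight ℂ R)) =
        finrank ℂ N.toSubalgebra.toSubmodule :=
      (Submodule.equivMapOfInjective (LinearMap.mulRight ℂ R)
        (fun _ _ h => hRunit.mul_right_cancel h) _).finrank_eq.symm
    have h2 : finrank ℂ ((peripheralSpan (twistedMap L ω)).map (LinearMap.mulRight ℂ ω)) =
        finrank ℂ (peripheralSpan (twistedMap L ω)) :=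
      (Submodule.equivMapOfInjective (LinearMap.mulRight ℂ ω)
        (fun _ _ h => hω.isUnit.mul_right_cancel h) _).finrank_eq.symm
    rw [h1, peripheralSpan_krausMap hω, h2]
    rfl
  refine ⟨M, d, m, J.comp (matrixIsometry W hW), ρ, hd, ?_, hρ, fun k => ?_, ?_⟩
  · refine Eq.trans ?_ hJ
    ext v
    constructor
    · rintro ⟨x, rfl⟩
      exact ⟨matrixIsometry W hW x, rfl⟩
    · rintro ⟨x, rfl⟩
      refine ⟨WithLp.toLp 2 (Wᴴ *ᵥ x.ofLp), ?_⟩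
      change J (matrixIsometry W hW (WithLp.toLp 2 (Wᴴ *ᵥ x.ofLp))) = J x
      congr 1
      rw [matrixIsometry_apply, Matrix.mulVec_mulVec, hW', Matrix.one_mulVec]
  · change (((ρ₀ k).trace)⁻¹ • ρ₀ k).trace = 1
    rw [Matrix.trace_smul, smul_eq_mul, inv_mul_cancel₀ (htr k).ne']
  · rw [hattr, hspan]
    have hkey : ∀ x : (∀ k, Matrix (Fin (d k)) (Fin (d k)) ℂ),
        W * ampl m x * Wᴴ * R = W * blockMatrix x ρ * Wᴴ := by
      intro x
      calc W * ampl m x * Wᴴ * R = W * (ampl m x * (Wᴴ * W) * blockMatrix 1 ρ) * Wᴴ := by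
            rw [hR]; simp only [Matrix.mul_assoc]
        _ = W * blockMatrix x ρ * Wᴴ := by
            rw [hW, Matrix.mul_one, ampl_mul_blockMatrix, mul_one]
    ext X
    constructor
    · rintro ⟨_, ⟨Z, hZ, rfl⟩, rfl⟩
      obtain ⟨x, rfl⟩ := (hN Z).mp hZ
      refine ⟨x, ?_⟩
      simp only
      rw [blockOperator_eq_liftOp, liftOp_comp_matrixIsometry, ← hkey]
      rfl
    · rintro ⟨x, rfl⟩
      simp only
      rw [blockOperator_eq_liftOp, liftOp_comp_matrixIsometry, ← hkey]
      exact ⟨_, ⟨_, hN' x, rfl⟩, rfl⟩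

end AttractorForm

/-! ### The automorphism of the block algebra induced by a channel -/

section AmplAlgebra

variable {M : ℕ} {d m : Fin M → ℕ}

theorem ampl_mul (x y : ∀ k, Matrix (Fin (d k)) (Fin (d k)) ℂ) :
    ampl m (x * y) = ampl m x * ampl m y := by
  rw [ampl, ampl, ampl, ← Matrix.blockDiagonal'_mul]
  simp only [← Matrix.mul_kronecker_mul, Matrix.one_mul, Pi.mul_apply]

theorem ampl_one : ampl m (1 : ∀ k, Matrix (Fin (d k)) (Fin (d k)) ℂ) = 1 :=
  blockMatrix_one_one

theorem ampl_add (x y : ∀ k, Matrix (Fin (d k)) (Fin (d k)) ℂ) :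
    ampl m (x + y) = ampl m x + ampl m y := by
  rw [ampl, ampl, ampl, ← Matrix.blockDiagonal'_add]
  congr 1
  ext1 k
  exact Matrix.add_kronecker _ _ _

theorem ampl_smul (c : ℂ) (x : ∀ k, Matrix (Fin (d k)) (Fin (d k)) ℂ) :
    ampl m (c • x) = c • ampl m x := by
  rw [ampl, ampl, ← Matrix.blockDiagonal'_smul]
  congr 1
  ext1 k
  exact Matrix.smul_kronecker c (x k) _

theorem blockMatrix_injective {ρ : ∀ k, Matrix (Fin (m k)) (Fin (m k)) ℂ}
    (hρ : ∀ k, (ρ k).trace ≠ 0) :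
    Function.Injective fun x : (∀ k, Matrix (Fin (d k)) (Fin (d k)) ℂ) => blockMatrix x ρ := by
  intro x y h
  funext k
  ext a b
  have h1 : ∀ p, x k a b * ρ k p p = y k a b * ρ k p p := fun p => by
    have h2 := congrFun (congrFun h ⟨k, a, p⟩) ⟨k, b, p⟩
    simpa only [blockMatrix, Matrix.blockDiagonal'_apply_eq, Matrix.kroneckerMap_apply] using h2
  have h2 : x k a b * (ρ k).trace = y k a b * (ρ k).trace := by
    rw [Matrix.trace, Finset.mul_sum, Finset.mul_sum]
    exact Finset.sum_congr rfl fun p _ => h1 p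
  exact mul_right_cancel₀ (hρ k) h2

theorem ampl_injective (hm : ∀ k, m k ≠ 0) : Function.Injective (ampl (d := d) m) :=
  blockMatrix_injective (ρ := fun _ => 1) fun k => by simpa using hm k

theorem trace_blockMatrix (x : ∀ k, Matrix (Fin (d k)) (Fin (d k)) ℂ)
    {ρ : ∀ k, Matrix (Fin (m k)) (Fin (m k)) ℂ} (hρ : ∀ k, (ρ k).trace = 1) :
    (blockMatrix x ρ).trace = ∑ k, (x k).trace := by
  rw [blockMatrix, Matrix.trace_blockDiagonal']
  refine Finset.sum_congr rfl fun k _ => ?_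
  rw [Matrix.trace_kronecker, hρ, mul_one]

theorem isUnit_of_posDef_blockMatrix {y : ∀ k, Matrix (Fin (d k)) (Fin (d k)) ℂ}
    {ρ : ∀ k, Matrix (Fin (m k)) (Fin (m k)) ℂ} (hm : ∀ k, m k ≠ 0)
    (h : (blockMatrix y ρ).PosDef) (k : Fin M) : IsUnit (y k) := by
  have h1 : (y k ⊗ₖ ρ k).PosDef := by
    have h2 := h.submatrix
      (e := fun p : Fin (d k) × Fin (m k) => (⟨k, p⟩ : Σ k, Fin (d k) × Fin (m k)))
      fun p q hpq => by simpa using hpq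
    convert h2 using 1
    ext p q
    rw [Matrix.submatrix_apply, blockMatrix, Matrix.blockDiagonal'_apply_eq]
  have h3 := h1.det_pos.ne'
  rw [Matrix.det_kronecker] at h3
  rw [Matrix.isUnit_iff_isUnit_det, isUnit_iff_ne_zero]
  intro h0
  rw [h0, Fintype.card_fin, zero_pow (hm k), zero_mul] at h3
  exact h3 rfl

end AmplAlgebra

section Automorphism

variable {H : Type*} [NormedAddCommGroup H] [InnerProductSpace ℂ H] [CompleteSpace H]
  [FiniteDimensional ℂ H] {M : ℕ} {d m : Fin M → ℕ}

theorem HasKrausForm.inner_eq_zero_of_mem_attractor {Ψ : End ℂ (H →L[ℂ] H)} (hΨ : HasKrausForm Ψ)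
    {X : H →L[ℂ] H} (hX : X ∈ attractor Ψ) {v : H}
    (hv : eigenprojection Ψ 1 (1 : H →L[ℂ] H) v = 0) (w : H) : inner ℂ v (X w) = 0 := by
  rw [attractor_eq_peripheralSpan] at hX
  refine peripheralSpan_induction (p := fun X : H →L[ℂ] H => inner ℂ v (X w) = 0)
    (fun μ X hμ hX => hΨ.inner_eq_zero_of_eigenprojection_eq_zero hμ hX hv w)
    (fun X Y hX hY => ?_) hX
  rw [add_apply, inner_add_right, hX, hY, add_zero]

/-- The support space of a block description of the attractor subspace is determined by the
attractor subspace. -/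
theorem HasKrausForm.range_eq_of_attractor_eq {Ψ : End ℂ (H →L[ℂ] H)} (hΨ : HasKrausForm Ψ)
    {V : EuclideanSpace ℂ (Σ k, Fin (d k) × Fin (m k)) →ₗᵢ[ℂ] H}
    {ρ : ∀ k, Matrix (Fin (m k)) (Fin (m k)) ℂ} (hρ : ∀ k, (ρ k).PosDef)
    (hattr : (attractor Ψ : Set (H →L[ℂ] H)) = Set.range fun x => blockOperator V x ρ) :
    LinearMap.range V.toLinearMap =
      LinearMap.range (eigenprojection Ψ 1 (1 : H →L[ℂ] H) : H →ₗ[ℂ] H) := by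
  set Q := eigenprojection Ψ 1 (1 : H →L[ℂ] H) with hQ
  have hpos : Q.IsPositive := hΨ.isPositive_eigenprojection_one
  have hfix : Ψ Q = Q := (hΨ.eigenprojection_one_spec 1).1
  apply le_antisymm
  · obtain ⟨B, hB, -⟩ := isUnit_iff_exists.mp
      (isUnit_blockMatrix (y := (1 : ∀ k, Matrix (Fin (d k)) (Fin (d k)) ℂ))
        (fun k => isUnit_one) fun k => (hρ k).isUnit)
    have h1 : liftOp V (blockMatrix 1 ρ) ∈ attractor Ψ := by
      rw [← SetLike.mem_coe, hattr]
      exact ⟨1, rfl⟩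
    have h2 : LinearMap.range (Q : H →ₗ[ℂ] H) = (LinearMap.ker (Q : H →ₗ[ℂ] H))ᗮ := by
      rw [← hpos.isSymmetric.orthogonal_range, Submodule.orthogonal_orthogonal]
    rintro _ ⟨y, rfl⟩
    rw [h2, Submodule.mem_orthogonal]
    intro v hv
    have h3 := hΨ.inner_eq_zero_of_mem_attractor h1 (v := v) hv
      (V (Matrix.toEuclideanCLM (𝕜 := ℂ) B y))
    rw [liftOp_apply, adjoint_apply_apply, ← mul_apply_eq_comp, ← map_mul, hB, map_one] at h3
    exact h3
  · have h1 : Q ∈ attractor Ψ := by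
      rw [attractor_eq_peripheralSpan]
      exact mem_peripheralSpan (μ := 1) (by simp) (by rw [hfix, one_smul])
    rw [← SetLike.mem_coe, hattr] at h1
    obtain ⟨x, hx⟩ := h1
    rintro _ ⟨v, rfl⟩
    rw [← hx]
    exact ⟨_, rfl⟩

/-- In block coordinates of the attractor subspace, and after division by a fixed point
`y₀`, a channel acts as a star automorphism of the block algebra. -/
theorem HasKrausForm.exists_block_automorphism {Ψ : End ℂ (H →L[ℂ] H)} (hΨ : HasKrausForm Ψ)
    {V : EuclideanSpace ℂ (Σ k, Fin (d k) × Fin (m k)) →ₗᵢ[ℂ] H}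
    {ρ : ∀ k, Matrix (Fin (m k)) (Fin (m k)) ℂ} (hρ : ∀ k, (ρ k).PosDef)
    (htr : ∀ k, (ρ k).trace = 1)
    (hattr : (attractor Ψ : Set (H →L[ℂ] H)) = Set.range fun x => blockOperator V x ρ) :
    ∃ (a : (∀ k, Matrix (Fin (d k)) (Fin (d k)) ℂ) →⋆ₐ[ℂ] (∀ k, Matrix (Fin (d k)) (Fin (d k)) ℂ))
      (y₀ : ∀ k, Matrix (Fin (d k)) (Fin (d k)) ℂ), Function.Bijective a ∧ (∀ k, IsUnit (y₀ k)) ∧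
      (∀ x, Ψ (blockOperator V (x * y₀) ρ) = blockOperator V (a x * y₀) ρ) ∧
      ∀ x, ∑ k, (a x k * y₀ k).trace = ∑ k, (x k * y₀ k).trace := by
  have hm : ∀ k, m k ≠ 0 := by
    intro k hk
    have h := htr k
    have : IsEmpty (Fin (m k)) := by rw [hk]; infer_instance
    rw [Matrix.trace, Finset.univ_eq_empty, Finset.sum_empty] at h
    exact zero_ne_one h
  obtain ⟨ι, _, L, ω, hL, hω, hfix, hlift, hQ, hattr'⟩ :=
    hΨ.exists_compression (hΨ.range_eq_of_attractor_eq hρ hattr)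
  have hmem : ∀ Y, Y ∈ peripheralSpan (krausMap L) ↔ ∃ x, Y = blockMatrix x ρ := by
    intro Y
    have h1 : liftOp V Y ∈ (attractor Ψ : Set (H →L[ℂ] H)) ↔ Y ∈ peripheralSpan (krausMap L) := by
      rw [SetLike.mem_coe, hattr', Submodule.mem_map]
      constructor
      · rintro ⟨Z, hZ, h⟩
        rwa [← liftOp_injective V h]
      · exact fun h => ⟨Y, h, rfl⟩
    rw [← h1, hattr]
    constructor
    · rintro ⟨x, hx⟩
      exact ⟨x, (liftOp_injective V hx).symm⟩
    · rintro ⟨x, rfl⟩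
      exact ⟨x, rfl⟩
  obtain ⟨y₀, hy₀⟩ := (hmem ω).mp (mem_peripheralSpan (μ := 1) (by simp) (by rw [hfix, one_smul]))
  have hunit : ∀ k, IsUnit (y₀ k) := isUnit_of_posDef_blockMatrix hm (hy₀ ▸ hω)
  obtain ⟨y₁, hy₁, hy₁'⟩ : ∃ y₁, y₁ * y₀ = 1 ∧ y₀ * y₁ = 1 := by
    have : IsUnit y₀ := Pi.isUnit_iff.mpr hunit
    exact ⟨_, this.val_inv_mul, this.mul_val_inv⟩
  have hampl : ∀ Z, Z ∈ peripheralSpan (twistedMap L ω) ↔ ∃ x, Z = ampl m x := by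
    intro Z
    constructor
    · intro hZ
      have h1 : Z * ω ∈ peripheralSpan (krausMap L) := by
        rw [peripheralSpan_krausMap hω]; exact ⟨Z, hZ, rfl⟩
      obtain ⟨y, hy⟩ := (hmem _).mp h1
      refine ⟨y * y₁, mul_right_injective_of_posDef hω ?_⟩
      simp only
      rw [hy, hy₀, ampl_mul_blockMatrix, mul_assoc, hy₁, mul_one]
    · rintro ⟨x, rfl⟩
      have h1 : ampl m x * ω ∈ peripheralSpan (krausMap L) :=
        (hmem _).mpr ⟨x * y₀, by rw [hy₀, ampl_mul_blockMatrix]⟩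
      rw [peripheralSpan_krausMap hω] at h1
      obtain ⟨Z, hZ, h⟩ := h1
      rwa [← mul_right_injective_of_posDef hω h]
  have hmaps : ∀ x, ∃ y, twistedMap L ω (ampl m x) = ampl m y := fun x =>
    (hampl _).mp (map_mem_peripheralSpan ((hampl _).mpr ⟨x, rfl⟩))
  choose f hf using hmaps
  have hinj := ampl_injective (d := d) hm
  have hfmul : ∀ x y, f (x * y) = f x * f y := fun x y => by
    apply hinj
    rw [← hf, ampl_mul, ampl_mul, (twistedMap_mul_mem hL hω hfix ((hampl _).mpr ⟨x, rfl⟩)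
      ((hampl _).mpr ⟨y, rfl⟩)).2, hf, hf]
  have hfone : f 1 = 1 := hinj (by rw [← hf, ampl_one, twistedMap_one hL hω hfix])
  have hfadd : ∀ x y, f (x + y) = f x + f y := fun x y =>
    hinj (by rw [← hf, ampl_add, ampl_add, map_add, hf, hf])
  have hfsmul : ∀ (c : ℂ) x, f (c • x) = c • f x := fun c x =>
    hinj (by rw [← hf, ampl_smul, ampl_smul, map_smul, hf])
  have hfstar : ∀ x, f (star x) = star (f x) := fun x => by
    apply hinj
    rw [← hf, ← ampl_conjTranspose, ← ampl_conjTranspose,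
      (twistedMap_conjTranspose_mem hL hω hfix ((hampl _).mpr ⟨x, rfl⟩)).2, hf]
  let a : (∀ k, Matrix (Fin (d k)) (Fin (d k)) ℂ) →⋆ₐ[ℂ] (∀ k, Matrix (Fin (d k)) (Fin (d k)) ℂ) :=
    { toFun := f
      map_one' := hfone
      map_mul' := hfmul
      map_zero' := by simpa using hfsmul 0 0
      map_add' := hfadd
      commutes' := fun c => by rw [Algebra.algebraMap_eq_smul_one, hfsmul, hfone]
      map_star' := hfstar }
  have hsurj : Function.Surjective a := by
    intro x
    obtain ⟨Y, hY, hYx⟩ := exists_map_eq_of_mem_peripheralSpan ((hampl _).mpr ⟨x, rfl⟩)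
    obtain ⟨y, rfl⟩ := (hampl _).mp hY
    exact ⟨y, hinj (by rw [← hYx, hf]; rfl)⟩
  have hkraus : ∀ x, krausMap L (blockMatrix (x * y₀) ρ) = blockMatrix (f x * y₀) ρ := by
    intro x
    rw [← ampl_mul_blockMatrix, ← hy₀, ← twistedMap_mul hω, hf, hy₀, ampl_mul_blockMatrix]
  refine ⟨a, y₀, ⟨?_, hsurj⟩, hunit, fun x => ?_, fun x => ?_⟩
  · exact (LinearMap.injective_iff_surjective (f := (a.toAlgHom.toLinearMap))).mpr hsurj
  · rw [blockOperator_eq_liftOp, hlift, hkraus]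
    rfl
  · have h := trace_krausMap hL (blockMatrix (x * y₀) ρ)
    rw [hkraus, trace_blockMatrix _ htr, trace_blockMatrix _ htr] at h
    exact h

end Automorphism

/-! ### Automorphisms of block algebras -/

section BlockAutomorphism

variable {M : ℕ} {d : Fin M → ℕ}

/-- An idempotent matrix which commutes with all matrices is zero or one. -/
theorem eq_zero_or_one_of_forall_commute {n : ℕ} {A : Matrix (Fin n) (Fin n) ℂ}
    (hA : A * A = A) (hc : ∀ B, Commute B A) : A = 0 ∨ A = 1 := by
  obtain ⟨c, rfl⟩ := Matrix.mem_range_scalar_of_commute_single (M := A)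
    fun i j _ => hc _
  rcases Nat.eq_zero_or_pos n with rfl | hn
  · exact Or.inl (Subsingleton.elim _ _)
  · have h : c * c = c := by
      have := congrFun (congrFun hA ⟨0, hn⟩) ⟨0, hn⟩
      simpa using this
    rcases eq_zero_or_eq_zero_of_mul_eq_zero (show c * (c - 1) = 0 by rw [mul_sub, h]; ring) with
      h0 | h1
    · left; rw [h0, map_zero]
    · right; rw [sub_eq_zero.mp h1, map_one]

theorem single_one_mul_single_one (k l : Fin M) (h : k ≠ l) :
    (Pi.single k 1 : ∀ k, Matrix (Fin (d k)) (Fin (d k)) ℂ) * Pi.single l 1 = 0 := by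
  funext j
  rw [Pi.mul_apply]
  by_cases hj : j = k
  · subst hj
    rw [Pi.single_eq_of_ne h, mul_zero]; rfl
  · rw [Pi.single_eq_of_ne hj, zero_mul]; rfl

/-- A star automorphism of a direct sum of full matrix algebras permutes the units of the
blocks. -/
theorem exists_perm_map_single_one (hd : ∀ k, 0 < d k)
    (a : (∀ k, Matrix (Fin (d k)) (Fin (d k)) ℂ) →⋆ₐ[ℂ] (∀ k, Matrix (Fin (d k)) (Fin (d k)) ℂ))
    (ha : Function.Bijective a) :
    ∃ σ : Equiv.Perm (Fin M), ∀ k, a (Pi.single k 1) = Pi.single (σ k) 1 := by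
  have hne : ∀ l, (1 : Matrix (Fin (d l)) (Fin (d l)) ℂ) ≠ 0 := fun l h => by
    have := congrFun (congrFun h ⟨0, hd l⟩) ⟨0, hd l⟩
    simp at this
  have h01 : ∀ k l, a (Pi.single k 1) l = 0 ∨ a (Pi.single k 1) l = 1 := by
    intro k l
    refine eq_zero_or_one_of_forall_commute ?_ fun B => ?_
    · rw [← Pi.mul_apply, ← map_mul, ← Pi.single_mul, mul_one]
    · obtain ⟨x, hx⟩ := ha.2 (Pi.single l B)
      have h1 : x * Pi.single k 1 = Pi.single k 1 * x := by
        funext j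
        rw [Pi.mul_apply, Pi.mul_apply]
        by_cases hj : j = k
        · subst hj; simp
        · rw [Pi.single_eq_of_ne hj, zero_mul, mul_zero]
      have h2 := congrFun (congrArg a h1) l
      rw [map_mul, map_mul, hx, Pi.mul_apply, Pi.mul_apply, Pi.single_eq_same] at h2
      exact h2
  -- every block unit is hit by exactly one image
  have hex : ∀ l, ∃ k, a (Pi.single k 1) l = 1 := by
    intro l
    by_contra hcon
    push Not at hcon
    have h1 : ∑ k, (Pi.single k 1 : ∀ k, Matrix (Fin (d k)) (Fin (d k)) ℂ) = 1 :=
      Finset.univ_sum_single 1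
    have h2 := congrFun (congrArg a h1) l
    rw [map_sum, map_one, Finset.sum_apply,
      Finset.sum_eq_zero fun k _ => (h01 k l).resolve_right (hcon k)] at h2
    exact hne l h2.symm
  choose τ hτ using hex
  have hτ' : ∀ k l, k ≠ τ l → a (Pi.single k 1) l = 0 := by
    intro k l hk
    have h1 := congrFun (congrArg a (single_one_mul_single_one (d := d) k (τ l) hk)) l
    rw [map_mul, Pi.mul_apply, hτ, mul_one, map_zero] at h1
    exact h1
  have hsurj : Function.Surjective τ := by
    intro k
    by_contra hcon
    push Not at hcon
    have h1 : a (Pi.single k 1) = 0 := funext fun l => hτ' k l (hcon l).symm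
    rw [← map_zero a] at h1
    have h2 := congrFun (ha.1 h1) k
    rw [Pi.single_eq_same] at h2
    exact hne k h2
  let τ' : Equiv.Perm (Fin M) := Equiv.ofBijective τ (Finite.surjective_iff_bijective.mp hsurj)
  refine ⟨τ'.symm, fun k => funext fun l => ?_⟩
  by_cases hl : k = τ l
  · have h2 : τ'.symm k = l := by rw [Equiv.symm_apply_eq]; exact hl
    subst h2
    have h3 : τ (τ'.symm k) = k := hl.symm
    rw [Pi.single_eq_same, ← hτ (τ'.symm k), h3]
  · rw [hτ' k l hl, Pi.single_eq_of_ne]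
    rintro rfl
    exact hl (τ'.apply_symm_apply k).symm

/-- Some positive power of an automorphism of a block algebra fixes the units of the blocks; the
exponent depends on the number of blocks only. -/
theorem pow_card_map_single_one (hd : ∀ k, 0 < d k)
    (a : (∀ k, Matrix (Fin (d k)) (Fin (d k)) ℂ) →⋆ₐ[ℂ] (∀ k, Matrix (Fin (d k)) (Fin (d k)) ℂ))
    (ha : Function.Bijective a) (k : Fin M) :
    a^[Nat.card (Equiv.Perm (Fin M))] (Pi.single k 1) = Pi.single k 1 := by
  obtain ⟨σ, hσ⟩ := exists_perm_map_single_one hd a ha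
  have h : ∀ n : ℕ, ∀ k, a^[n] (Pi.single k 1) = Pi.single ((σ ^ n) k) 1 := by
    intro n
    induction n with
    | zero => intro k; rfl
    | succ n ih =>
      intro k
      rw [Function.iterate_succ_apply', ih, hσ, pow_succ', Equiv.Perm.mul_apply]
  rw [h, pow_card_eq_one', Equiv.Perm.one_apply]

/-- A star automorphism of a full matrix algebra is implemented by a unitary. -/
theorem exists_unitary_of_bijective {n : ℕ}
    (b : Matrix (Fin n) (Fin n) ℂ →⋆ₐ[ℂ] Matrix (Fin n) (Fin n) ℂ) (hb : Function.Bijective b) :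
    ∃ U : Matrix (Fin n) (Fin n) ℂ, U * Uᴴ = 1 ∧ Uᴴ * U = 1 ∧ ∀ A, b A = U * A * Uᴴ := by
  let e := Matrix.toEuclideanCLM (𝕜 := ℂ) (n := Fin n)
  let f := (e.symm.trans (StarAlgEquiv.ofBijective b hb)).trans e
  obtain ⟨u, hu⟩ := StarAlgEquiv.eq_linearIsometryEquivConjStarAlgEquiv f
    (LinearMap.continuous_of_finiteDimensional f.toAlgEquiv.toLinearMap)
  have hf : ∀ A, e (b A) = u.conjStarAlgEquiv (e A) := fun A => by
    rw [← hu]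
    simp [f]
  let w := Unitary.linearIsometryEquiv.symm u
  have hstar : ∀ A : Matrix (Fin n) (Fin n) ℂ, e Aᴴ = star (e A) := fun A => map_star e A
  have hw : e (e.symm (w : _)) = (w : EuclideanSpace ℂ (Fin n) →L[ℂ] EuclideanSpace ℂ (Fin n)) :=
    e.apply_symm_apply _
  refine ⟨e.symm (w : _), ?_, ?_, fun A => ?_⟩
  · apply EquivLike.injective e
    rw [map_mul, hstar, hw, map_one]
    exact Unitary.mul_star_self_of_mem w.2
  · apply EquivLike.injective e
    rw [map_mul, hstar, hw, map_one]
    exact Unitary.star_mul_self_of_mem w.2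
  · apply EquivLike.injective e
    rw [hf, map_mul, map_mul, hstar, hw, ← Unitary.conjStarAlgAut_symm_unitaryLinearIsometryEquiv]
    rfl

/-- A star automorphism of a direct sum of full matrix algebras which fixes the units of the blocks
is implemented by unitaries, block by block. -/
theorem exists_unitaries_of_map_single_one
    (b : (∀ k, Matrix (Fin (d k)) (Fin (d k)) ℂ) →⋆ₐ[ℂ] (∀ k, Matrix (Fin (d k)) (Fin (d k)) ℂ))
    (hb : Function.Bijective b) (hfix : ∀ k, b (Pi.single k 1) = Pi.single k 1) :
    ∃ U : ∀ k, Matrix (Fin (d k)) (Fin (d k)) ℂ, (∀ k, U k * (U k)ᴴ = 1) ∧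
      (∀ k, (U k)ᴴ * U k = 1) ∧ ∀ x k, b x k = U k * x k * (U k)ᴴ := by
  have hblock : ∀ x k, b x k = b (Pi.single k (x k)) k := by
    intro x k
    have h1 : Pi.single k (x k) = x * Pi.single k 1 := by
      funext j
      rw [Pi.mul_apply]
      by_cases hj : j = k
      · subst hj; simp
      · rw [Pi.single_eq_of_ne hj, Pi.single_eq_of_ne hj, mul_zero]
    rw [h1, map_mul, hfix, Pi.mul_apply, Pi.single_eq_same, mul_one]
  have hoff : ∀ k l A, l ≠ k → b (Pi.single k A) l = 0 := by
    intro k l A hl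
    have h1 : (Pi.single k A : ∀ k, Matrix (Fin (d k)) (Fin (d k)) ℂ) =
        Pi.single k A * Pi.single k 1 := by
      rw [← Pi.single_mul, mul_one]
    rw [h1, map_mul, hfix, Pi.mul_apply, Pi.single_eq_of_ne hl, mul_zero]
  have hU : ∀ k, ∃ U : Matrix (Fin (d k)) (Fin (d k)) ℂ, U * Uᴴ = 1 ∧ Uᴴ * U = 1 ∧
      ∀ A, b (Pi.single k A) k = U * A * Uᴴ := by
    intro k
    let β : Matrix (Fin (d k)) (Fin (d k)) ℂ →⋆ₐ[ℂ] Matrix (Fin (d k)) (Fin (d k)) ℂ :=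
      { toFun := fun A => b (Pi.single k A) k
        map_one' := by rw [hfix, Pi.single_eq_same]
        map_mul' := fun A B => by rw [Pi.single_mul, map_mul, Pi.mul_apply]
        map_zero' := by rw [Pi.single_zero, map_zero, Pi.zero_apply]
        map_add' := fun A B => by rw [Pi.single_add, map_add, Pi.add_apply]
        commutes' := fun c => by
          rw [Algebra.algebraMap_eq_smul_one, Pi.single_smul, map_smul, hfix, Pi.smul_apply,
            Pi.single_eq_same]
        map_star' := fun A => by rw [Pi.single_star, map_star, Pi.star_apply] }
    have hinj : Function.Injective β := by
      intro A B hAB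
      have h1 : b (Pi.single k A) = b (Pi.single k B) := by
        funext l
        by_cases hl : l = k
        · subst hl; exact hAB
        · rw [hoff _ _ _ hl, hoff _ _ _ hl]
      exact Pi.single_injective k (hb.1 h1)
    exact exists_unitary_of_bijective β
      ⟨hinj, (LinearMap.injective_iff_surjective (f := β.toAlgHom.toLinearMap)).mp hinj⟩
  choose U h1 h2 h3 using hU
  exact ⟨U, h1, h2, fun x k => by rw [hblock, h3]⟩

end BlockAutomorphism

/-! ### Infinitely divisible channels -/

section InfinitelyDivisible

variable {H : Type*} [NormedAddCommGroup H] [InnerProductSpace ℂ H] [CompleteSpace H]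
  [FiniteDimensional ℂ H] {M : ℕ} {d m : Fin M → ℕ}

theorem IsQuantumChannel.hasKrausForm {Φ : End ℂ (H →L[ℂ] H)} (h : IsQuantumChannel Φ) :
    HasKrausForm Φ := by
  obtain ⟨K, hK, hK1⟩ := h.exists_kraus
  exact ⟨_, inferInstance, K, hK, hK1⟩

theorem blockOperator_injective (V : EuclideanSpace ℂ (Σ k, Fin (d k) × Fin (m k)) →ₗᵢ[ℂ] H)
    {ρ : ∀ k, Matrix (Fin (m k)) (Fin (m k)) ℂ} (htr : ∀ k, (ρ k).trace = 1) :
    Function.Injective fun x : (∀ k, Matrix (Fin (d k)) (Fin (d k)) ℂ) => blockOperator V x ρ :=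
  fun _ _ h => blockMatrix_injective (fun k => by rw [htr k]; exact one_ne_zero)
    (liftOp_injective V h)

/-- An infinitely divisible channel is a power of a channel whose exponent kills every permutation
of the blocks of its attractor subspace; hence the automorphism of the block algebra which it
induces fixes the units of the blocks. -/
theorem IsInfinitelyDivisible.exists_block_automorphism {Φ : End ℂ (H →L[ℂ] H)}
    (hΦ : IsInfinitelyDivisible Φ) (hd : ∀ k, 0 < d k)
    {V : EuclideanSpace ℂ (Σ k, Fin (d k) × Fin (m k)) →ₗᵢ[ℂ] H}
    {ρ : ∀ k, Matrix (Fin (m k)) (Fin (m k)) ℂ} (hρ : ∀ k, (ρ k).PosDef)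
    (htr : ∀ k, (ρ k).trace = 1)
    (hattr : (attractor Φ : Set (H →L[ℂ] H)) = Set.range fun x => blockOperator V x ρ) :
    ∃ (b : (∀ k, Matrix (Fin (d k)) (Fin (d k)) ℂ) →⋆ₐ[ℂ] (∀ k, Matrix (Fin (d k)) (Fin (d k)) ℂ))
      (y₀ : ∀ k, Matrix (Fin (d k)) (Fin (d k)) ℂ), Function.Bijective b ∧
      (∀ k, b (Pi.single k 1) = Pi.single k 1) ∧ (∀ k, IsUnit (y₀ k)) ∧
      (∀ x, Φ (blockOperator V (x * y₀) ρ) = blockOperator V (b x * y₀) ρ) ∧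
      ∀ x, ∑ k, (b x k * y₀ k).trace = ∑ k, (x k * y₀ k).trace := by
  obtain ⟨Ψ, hΨ, hpow⟩ := hΦ.2 (Nat.card (Equiv.Perm (Fin M))) Nat.card_pos
  have hattr' : attractor Φ = attractor Ψ := by
    rw [attractor_eq_peripheralSpan, attractor_eq_peripheralSpan, hpow,
      peripheralSpan_pow _ Nat.card_pos.ne']
  rw [hattr'] at hattr
  obtain ⟨a, y₀, ha, hy₀, hΨa, hatr⟩ := hΨ.hasKrausForm.exists_block_automorphism hρ htr hattr
  have hcoe : ∀ n : ℕ, ⇑(a ^ n) = a^[n] := by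
    intro n
    induction n with
    | zero => rfl
    | succ n ih => rw [pow_succ', Function.iterate_succ', ← ih]; rfl
  refine ⟨a ^ Nat.card (Equiv.Perm (Fin M)), y₀, ?_, ?_, hy₀, ?_, ?_⟩
  · rw [hcoe]; exact ha.iterate _
  · rw [hcoe]; exact pow_card_map_single_one hd a ha
  · rw [hcoe, hpow]
    generalize Nat.card (Equiv.Perm (Fin M)) = n
    induction n with
    | zero => intro x; rfl
    | succ n ih =>
      intro x
      rw [pow_succ, Function.iterate_succ_apply, Module.End.mul_apply, hΨa, ih]
  · rw [hcoe]
    generalize Nat.card (Equiv.Perm (Fin M)) = n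
    induction n with
    | zero => intro x; rfl
    | succ n ih =>
      intro x
      rw [Function.iterate_succ_apply, ih, hatr]

/-- If the permutation moved a block `k`, it would move the operator `y₀` cut down to that block,
which is a nonzero fixed point. -/
theorem AsymptoticForm.perm_eq_one {Φ : End ℂ (H →L[ℂ] H)} (hΦ : IsInfinitelyDivisible Φ)
    (F : AsymptoticForm Φ) : F.π = 1 := by
  obtain ⟨b, y₀, -, hb, hy₀, hΦb, -⟩ :=
    hΦ.exists_block_automorphism F.d_pos F.ρ_posDef F.ρ_trace F.attractor_eq
  ext1 k
  rw [Equiv.Perm.one_apply]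
  by_contra hk
  have hmem : blockOperator F.V (Pi.single k 1 * y₀) F.ρ ∈ attractor Φ := by
    rw [← SetLike.mem_coe, F.attractor_eq]
    exact ⟨_, rfl⟩
  have h1 := F.map_eq ⟨_, hmem⟩ _ rfl
  have h2 : Φ (blockOperator F.V (Pi.single k 1 * y₀) F.ρ) = _ := h1
  rw [hΦb, hb] at h2
  have h3 := congrFun (blockOperator_injective F.V F.ρ_trace h2) k
  rw [Pi.mul_apply, Pi.single_eq_same, one_mul, Pi.mul_apply, Pi.single_eq_of_ne hk, zero_mul,
    Matrix.mul_zero, Matrix.zero_mul] at h3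
  have : Nonempty (Fin (F.d k)) := ⟨⟨0, F.d_pos k⟩⟩
  exact (hy₀ k).ne_zero h3

/-- In block coordinates of its attractor subspace an infinitely divisible channel acts as a
unitary conjugation of each block. That the fixed point `y₀` commutes with the unitaries is a
consequence of trace preservation. -/
theorem IsInfinitelyDivisible.exists_block_unitaries {Φ : End ℂ (H →L[ℂ] H)}
    (hΦ : IsInfinitelyDivisible Φ) (hd : ∀ k, 0 < d k)
    {V : EuclideanSpace ℂ (Σ k, Fin (d k) × Fin (m k)) →ₗᵢ[ℂ] H}
    {ρ : ∀ k, Matrix (Fin (m k)) (Fin (m k)) ℂ} (hρ : ∀ k, (ρ k).PosDef)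
    (htr : ∀ k, (ρ k).trace = 1)
    (hattr : (attractor Φ : Set (H →L[ℂ] H)) = Set.range fun x => blockOperator V x ρ) :
    ∃ U : ∀ k, Matrix (Fin (d k)) (Fin (d k)) ℂ, (∀ k, U k * (U k)ᴴ = 1) ∧
      (∀ k, (U k)ᴴ * U k = 1) ∧
      ∀ x, Φ (blockOperator V x ρ) = blockOperator V (fun k => U k * x k * (U k)ᴴ) ρ := by
  obtain ⟨b, y₀, hbij, hb, hy₀, hΦb, hbtr⟩ := hΦ.exists_block_automorphism hd hρ htr hattr
  obtain ⟨U, hU, hU', hbU⟩ := exists_unitaries_of_map_single_one b hbij hb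
  refine ⟨U, hU, hU', fun x => ?_⟩
  have hcomm : ∀ k, (U k)ᴴ * y₀ k = y₀ k * (U k)ᴴ := by
    intro k
    have h1 : (U k)ᴴ * y₀ k * U k = y₀ k := by
      rw [Matrix.ext_iff_trace_mul_left]
      intro A
      have h2 := hbtr (Pi.single k A)
      rw [Finset.sum_eq_single k, Finset.sum_eq_single k, hbU, Pi.single_eq_same] at h2
      · rw [← h2, ← Matrix.mul_assoc, Matrix.trace_mul_comm]
        simp only [Matrix.mul_assoc]
      · intro l _ hl
        rw [Pi.single_eq_of_ne hl, Matrix.zero_mul, Matrix.trace_zero]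
      · simp
      · intro l _ hl
        rw [hbU, Pi.single_eq_of_ne hl, Matrix.mul_zero, Matrix.zero_mul, Matrix.zero_mul,
          Matrix.trace_zero]
      · simp
    calc (U k)ᴴ * y₀ k = (U k)ᴴ * y₀ k * (U k * (U k)ᴴ) := by rw [hU, Matrix.mul_one]
      _ = y₀ k * (U k)ᴴ := by rw [← Matrix.mul_assoc, h1]
  obtain ⟨y₁, hy₁⟩ : ∃ y₁, y₁ * y₀ = 1 := (Pi.isUnit_iff.mpr hy₀).exists_left_inv
  have hx : x = x * y₁ * y₀ := by rw [mul_assoc, hy₁, mul_one]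
  conv_lhs => rw [hx, hΦb]
  congr 1
  funext k
  conv_rhs => rw [hx]
  rw [Pi.mul_apply, hbU, Pi.mul_apply (x * y₁), Matrix.mul_assoc, hcomm]
  simp only [Matrix.mul_assoc]

theorem star_liftOp_add {I : Type*} [Fintype I] [DecidableEq I]
    (V : EuclideanSpace ℂ I →ₗᵢ[ℂ] H) (W : Matrix I I ℂ) :
    star (liftOp V W + (1 - liftOp V 1)) = liftOp V Wᴴ + (1 - liftOp V 1) := by
  rw [star_add, star_sub, star_one, ← liftOp_conjTranspose, ← liftOp_conjTranspose,
    Matrix.conjTranspose_one]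

/-- A unitary matrix on the range of `V`, extended by the identity on the orthogonal complement. -/
theorem liftOp_add_mem_unitary {I : Type*} [Fintype I] [DecidableEq I]
    (V : EuclideanSpace ℂ I →ₗᵢ[ℂ] H) {W : Matrix I I ℂ} (hW : W * Wᴴ = 1) (hW' : Wᴴ * W = 1) :
    liftOp V W + (1 - liftOp V 1) ∈ unitary (H →L[ℂ] H) := by
  rw [Unitary.mem_iff, star_liftOp_add]
  constructor
  · simp only [add_mul, mul_add, sub_mul, mul_sub, one_mul, mul_one, ← liftOp_mul, hW']
    abel
  · simp only [add_mul, mul_add, sub_mul, mul_sub, one_mul, mul_one, ← liftOp_mul, hW]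
    abel

theorem liftOp_add_mul_liftOp_mul_star {I : Type*} [Fintype I] [DecidableEq I]
    (V : EuclideanSpace ℂ I →ₗᵢ[ℂ] H) (W Y : Matrix I I ℂ) :
    (liftOp V W + (1 - liftOp V 1)) * liftOp V Y * star (liftOp V W + (1 - liftOp V 1)) =
      liftOp V (W * Y * Wᴴ) := by
  rw [star_liftOp_add]
  simp only [add_mul, mul_add, sub_mul, mul_sub, one_mul, mul_one, ← liftOp_mul]
  abel

end InfinitelyDivisible

end QuantumAsymptotics

theorem theorem5p1 {H : Type*} [NormedAddCommGroup H] [InnerProductSpace ℂ H] [CompleteSpace H]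
    [FiniteDimensional ℂ H] (Φ : Module.End ℂ (H →L[ℂ] H))
    (hΦ : QuantumAsymptotics.IsInfinitelyDivisible Φ) :
    Nonempty (QuantumAsymptotics.AsymptoticForm Φ) ∧
      (∀ F : QuantumAsymptotics.AsymptoticForm Φ, F.π = 1) ∧
      QuantumAsymptotics.HasUnitaryAsymptotics Φ := by
  obtain ⟨M, d, m, V, ρ, hd, hV, hρ, htr, hattr⟩ := hΦ.1.hasKrausForm.exists_attractor_form
  obtain ⟨U, hU, hU', hΦU⟩ := hΦ.exists_block_unitaries hd hρ htr hattr
  refine ⟨⟨⟨M, d, m, hd, V, hV, ρ, hρ, htr, hattr, 1, U, hU, hU', fun X x hX => ?_⟩⟩,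
    fun F => F.perm_eq_one hΦ, ?_⟩
  · change Φ X = _
    rw [hX, hΦU]
    rfl
  · have hW : QuantumAsymptotics.ampl m U * (QuantumAsymptotics.ampl m U)ᴴ = 1 := by
      rw [QuantumAsymptotics.ampl_conjTranspose, ← QuantumAsymptotics.ampl_mul,
        ← QuantumAsymptotics.ampl_one]
      exact congrArg _ (funext hU)
    have hW' : (QuantumAsymptotics.ampl m U)ᴴ * QuantumAsymptotics.ampl m U = 1 := by
      rw [QuantumAsymptotics.ampl_conjTranspose, ← QuantumAsymptotics.ampl_mul,
        ← QuantumAsymptotics.ampl_one]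
      exact congrArg _ (funext hU')
    refine ⟨_, QuantumAsymptotics.liftOp_add_mem_unitary V hW hW', fun X => ?_⟩
    have hX : (X : H →L[ℂ] H) ∈ (QuantumAsymptotics.attractor Φ : Set (H →L[ℂ] H)) := X.2
    rw [hattr] at hX
    obtain ⟨x, hx⟩ := hX
    change Φ X = _
    rw [← hx]
    simp only
    rw [hΦU, QuantumAsymptotics.blockOperator_eq_liftOp, QuantumAsymptotics.blockOperator_eq_liftOp,
      QuantumAsymptotics.liftOp_add_mul_liftOp_mul_star, QuantumAsymptotics.ampl_mul_blockMatrix,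
      QuantumAsymptotics.ampl_conjTranspose, QuantumAsymptotics.blockMatrix_mul_ampl]
    rfl
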